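/- Let $H$ be a finite group with $M$ conjugacy classes and let $X$ be an infinite set. Let $\mathrm{Alt}(X)$ be the finitary alternating group of $X$ (the products of an even number of transpositions of $X$), let $H^{(X)}$ be the group of finitely supported functions $X\to H$, and let $W=H\wr_X\mathrm{Alt}(X)=H^{(X)}\rtimes\mathrm{Alt}(X)$ with multiplication $(\varphi,f)(\psi,g)=(\varphi\cdot(\psi\circ f^{-1}),\,fg)$. For $u\in X$ and $a\in H\setminus\{1\}$ let $\varphi_u^a\in H^{(X)}$ be the function with value $a$ at $u$ and $1$ elsewhere. For $S\subseteq W$ let $\gamma_{W,S}(n)\in\mathbb N\cup\{0,\infty\}$ be the number of conjugacy classes of $W$ whose smallest word length with respect to $S\cup S^{-1}$ is $n$, and let $\widetilde H^{\mathrm{conj}}_{W,S}=\limsup_{n\to\infty}\frac{\log\gamma_{W,S}(n)}{\sqrt n}$ (in $[-\infty,\infty]$). Call $S\subseteq W$ sufficiently large if the following hold. (0) Every element of $S$ is a $3$-cycle in $\mathrm{Alt}(X)$ or one of the $\varphi_u^a$ with $a\ne1$. Call a $3$-element set that is the support of a $3$-cycle in $S$ a triple, and call a point $u\in X$ full if $\varphi_u^a\in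 S$ for all $a\in H\setminus\{1\}$. (i) The graph on $X$ joining two distinct points whenever they lie in a common triple is connected. (ii) For all finite sequences of integers $a_1,\dots,a_k\ge0$ and of pairs of integers $(b_1,c_1),\dots,(b_l,c_l)$ with $b_j,c_j\ge1$, there are pairwise disjoint sets $V_1,\dots,V_k,\,P_1\cup Q_1,\dots,P_l\cup Q_l\subseteq X$ such that each $V_i$ is the vertex set of a tree of $a_i$ triples (obtained from one point by $a_i$ times adding the other two points of a triple that meets the set in exactly one point), each $(P_j,Q_j)$ is obtained from a pair $(\{x,y\},\{z,w\})$, where $x,y,z,w$ are distinct and $\{x,y,z\}$, $\{y,z,w\}$ are triples, by adding in the same way $b_j-1$ triples to the first set and $c_j-1$ triples to the second set, in any order (the two added points always lying outside both sets), and each $V_i$, each $P_j$ and each $Q_j$ contains a full point. (Such a set generates $W$; the set of all $3$-cycles and all $\varphi_u^a$ is an example.) Then, for every sufficiently large $S\subseteq W$, $$\widetilde H^{\mathrm{conj}}_{W,S}=2\pi\sqrt{\frac{M}{3}}.$$ -/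

import Mathlib

noncomputable section

/-! ### Word length, conjugacy length, conjugacy growth -/

section Growth

variable {G : Type*} [Group G]

/-- The lengths of the words in `S ∪ S⁻¹` that represent `g`. -/
def wordLengths (S : Set G) (g : G) : Set ℕ :=
  {m | ∃ l : List G, l.length = m ∧ (∀ s ∈ l, s ∈ S ∨ s⁻¹ ∈ S) ∧ l.prod = g}

/-- The word length of `g` with respect to `S` (infinite if `g` is not in the subgroup
generated by `S`). -/
def wordLength (S : Set G) (g : G) : ℕ∞ :=
  ⨅ m ∈ wordLengths S g, (m : ℕ∞)

/-- The conjugacy length: the smallest word length in a conjugacy class. -/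
def conjLength (S : Set G) (c : ConjClasses G) : ℕ∞ :=
  ⨅ g ∈ c.carrier, wordLength S g

/-- The number of conjugacy classes with smallest word length `n`. -/
def conjGrowth (S : Set G) (n : ℕ) : ℕ∞ :=
  Set.encard {c : ConjClasses G | conjLength S c = n}

/-- The exponential rate of conjugacy growth, `limsup log γ(n) / √n`, computed in the extended
reals with the extended logarithm (`log 0 = ⊥`, `log ⊤ = ⊤`). -/
def conjGrowthRate (S : Set G) : EReal :=
  Filter.limsup
    (fun n : ℕ => ENNReal.log ((conjGrowth S n : ℕ∞) : ENNReal) / ((Real.sqrt n : ℝ) : EReal))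
    Filter.atTop

end Growth

/-! ### The finitary alternating group and the permutational wreath product -/

open Classical in
/-- The finitary alternating group of `X`: the permutations that are products of an even number
of transpositions (such permutations have finite support). -/
def finAlt (X : Type*) : Subgroup (Equiv.Perm X) where
  carrier := {σ | ∃ l : List (Equiv.Perm X), (∀ τ ∈ l, τ.IsSwap) ∧ Even l.length ∧ l.prod = σ}
  one_mem' := ⟨[], by simp⟩
  mul_mem' := by
    rintro _ _ ⟨l, hl, el, rfl⟩ ⟨m, hm, em, rfl⟩
    refine ⟨l ++ m, ?_, ?_, by simp⟩
    · intro τ hτ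
      rcases List.mem_append.1 hτ with h | h
      · exact hl τ h
      · exact hm τ h
    · rw [List.length_append]
      exact el.add em
  inv_mem' := by
    rintro _ ⟨l, hl, el, rfl⟩
    refine ⟨(l.map (fun τ => τ⁻¹)).reverse, ?_, by simpa using el, ?_⟩
    · intro τ hτ
      simp only [List.mem_reverse, List.mem_map] at hτ
      obtain ⟨ρ, hρ, rfl⟩ := hτ
      obtain ⟨x, y, hxy, rfl⟩ := hl ρ hρ
      exact ⟨x, y, hxy, by rw [Equiv.swap_inv]⟩
    · rw [List.prod_inv_reverse]

/-- `H^(X)`: the functions `X → H` with finite support, under pointwise multiplication. -/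
def finFun (H X : Type*) [Group H] : Subgroup (X → H) where
  carrier := {f | (Function.mulSupport f).Finite}
  one_mem' := by simp
  mul_mem' := fun hf hg => (hf.union hg).subset (Function.mulSupport_mul _ _)
  inv_mem' := fun {f} hf => by
    exact Set.Finite.subset hf (fun x hx h => hx (by simp [h]))

/-- The action of permutations on `H^(X)`: `σ` sends `ψ` to `ψ ∘ σ⁻¹`. -/
def permFinFun (H X : Type*) [Group H] : Equiv.Perm X →* MulAut (finFun H X) where
  toFun σ :=
    { toFun := fun ψ => ⟨fun x => ψ.1 (σ⁻¹ x),
        Set.Finite.preimage (f := fun x => σ⁻¹ x) (σ⁻¹).injective.injOn ψ.2⟩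
      invFun := fun ψ => ⟨fun x => ψ.1 (σ x),
        Set.Finite.preimage (f := fun x => σ x) σ.injective.injOn ψ.2⟩
      left_inv := fun ψ => by ext x; simp
      right_inv := fun ψ => by ext x; simp
      map_mul' := fun ψ χ => rfl }
  map_one' := by ext ψ x; rfl
  map_mul' σ τ := by ext ψ x; simp [mul_inv_rev]

/-- The permutational wreath product `H ≀_X Alt(X) = H^(X) ⋊ Alt(X)`, with multiplication
`(φ, f) (ψ, g) = (φ f(ψ), f g)`. -/
abbrev AltWreath (H X : Type*) [Group H] : Type _ :=
  finFun H X ⋊[(permFinFun H X).comp (finAlt X).subtype] finAlt X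

/-! ### Sufficiently large generating sets -/

section Large

variable {H X : Type*} [Group H]

open Classical in
/-- `w` is the element `φ_u^a` of `H^(X)`: the function with value `a` at `u` and `1` elsewhere. -/
def IsPoint (w : AltWreath H X) (u : X) (a : H) : Prop :=
  w.right = 1 ∧ (w.left : X → H) = Pi.mulSingle u a

open Classical in
/-- `w` is the 3-cycle `x ↦ y ↦ z ↦ x` of `Alt(X)`. -/
def IsThreeCyc (w : AltWreath H X) (x y z : X) : Prop :=
  x ≠ y ∧ y ≠ z ∧ x ≠ z ∧ w.left = 1 ∧
    (w.right : Equiv.Perm X) = Equiv.swap x y * Equiv.swap y z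

/-- `T_H`: all `φ_u^a` with `a ≠ 1`. -/
def pointGens (H X : Type*) [Group H] : Set (AltWreath H X) :=
  {w | ∃ u a, a ≠ 1 ∧ IsPoint w u a}

/-- All 3-cycles. -/
def threeCycGens (H X : Type*) [Group H] : Set (AltWreath H X) :=
  {w | ∃ x y z, IsThreeCyc w x y z}

/-- `{x, y, z}` is the support of a 3-cycle in `S` (either of the two 3-cycles with this support,
as words may use inverses). This is symmetric in `x, y, z`. -/
def IsTriple (S : Set (AltWreath H X)) (x y z : X) : Prop :=
  ∃ w ∈ S, IsThreeCyc w x y z ∨ IsThreeCyc w x z y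

/-- The graph on `X` that joins two points when they lie in the support of a common 3-cycle
of `S`. -/
def tripleGraph (S : Set (AltWreath H X)) : SimpleGraph X :=
  SimpleGraph.fromRel (fun x y => ∃ z, IsTriple S x y z)

/-- The point `u` is full: `S` contains `φ_u^a` for every `a ≠ 1`. -/
def IsFull (S : Set (AltWreath H X)) (u : X) : Prop :=
  ∀ a : H, a ≠ 1 → ∃ w ∈ S, IsPoint w u a

/-- `V` is the vertex set of a tree built from `a` triples of `S`; it has `2 * a + 1` points. (The
3-cycles of such a tree, each used once, multiply to a cycle of length `2 * a + 1`.) -/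
inductive IsTripleTree (S : Set (AltWreath H X)) : ℕ → Set X → Prop
  | vertex (x : X) : IsTripleTree S 0 {x}
  | attach {a : ℕ} {V : Set X} {x y z : X} : IsTripleTree S a V →
      x ∈ V → y ∉ V → z ∉ V → IsTriple S x y z → IsTripleTree S (a + 1) (V ∪ {y, z})

/-- Two triples `{x, y, z}`, `{y, z, w}` of `S` that share two points give the pair of sets
`{x, y}`, `{z, w}`; each of the two sets is then enlarged by attaching triples at one of its points,
as in a tree. `P` has `2 * b` points, `Q` has `2 * c` points, and `b + c` triples are used. (The
3-cycles of such a configuration, each used once, multiply to the product of a cycle on `P` and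
a cycle on `Q`.) -/
inductive IsEvenPair (S : Set (AltWreath H X)) : ℕ → ℕ → Set X → Set X → Prop
  | base {x y z w : X} : x ≠ w → IsTriple S x y z → IsTriple S y z w →
      IsEvenPair S 1 1 {x, y} {z, w}
  | attachLeft {b c : ℕ} {P Q : Set X} {x y z : X} : IsEvenPair S b c P Q →
      x ∈ P → y ∉ P ∪ Q → z ∉ P ∪ Q → IsTriple S x y z →
      IsEvenPair S (b + 1) c (P ∪ {y, z}) Q
  | attachRight {b c : ℕ} {P Q : Set X} {x y z : X} : IsEvenPair S b c P Q →
      x ∈ Q → y ∉ P ∪ Q → z ∉ P ∪ Q → IsTriple S x y z →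
      IsEvenPair S b (c + 1) P (Q ∪ {y, z})

/-- `S` is sufficiently large (partition-complete) in `H ≀_X Alt(X)`: it consists of elements
`φ_u^a` and 3-cycles, its 3-cycles connect `X`, and for all prescribed sizes it contains a disjoint
family of trees of 3-cycles and of even pairs of these sizes, every tree and both members of every
pair containing a full point. The family of all `φ_u^a` and all 3-cycles is an example. -/
structure IsSufficientlyLarge (S : Set (AltWreath H X)) : Prop where
  subset : S ⊆ pointGens H X ∪ threeCycGens H X
  connected : (tripleGraph S).Connected
  complete : ∀ (k l : ℕ) (a : Fin k → ℕ) (b c : Fin l → ℕ),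
    (∀ j, 1 ≤ b j) → (∀ j, 1 ≤ c j) →
    ∃ (V : Fin k → Set X) (P Q : Fin l → Set X),
      (∀ i, IsTripleTree S (a i) (V i) ∧ ∃ u ∈ V i, IsFull S u) ∧
      (∀ j, IsEvenPair S (b j) (c j) (P j) (Q j) ∧
        (∃ u ∈ P j, IsFull S u) ∧ (∃ u ∈ Q j, IsFull S u)) ∧
      Pairwise (fun p q : Fin k ⊕ Fin l =>
        Disjoint (Sum.elim V (fun j => P j ∪ Q j) p) (Sum.elim V (fun j => P j ∪ Q j) q))

end Large

end

/-! The group `W` acts on `X × H` by maps commuting with right translation by `H`. An element given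
by a word splits into finitely many disjoint cycles over `X`. Following a cycle of `ℓ` points once
around, from `(x, 1)` to `(x, h)`, gives a holonomy `h` that is well defined up to conjugacy. Call
`(ℓ - 1, class of h)` the shape of the cycle. The multiset of nontrivial shapes is a complete
conjugacy invariant (`CycleDecomp.shapes_eq_of_isConj`, `CycleDecomp.isConj`): as `X` is infinite, a
conjugating permutation can be made even by a transposition far away. The problem thus becomes one
of counting coloured partitions.

Upper bound. Let a cycle weigh `ℓ - 1`, plus `1` if its holonomy is nontrivial. Multiplying by a
point generator or by a transposition raises the total weight by at most `1`, and a 3-cycle is two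
transpositions, so a word of length `n` has weight at most `2n` (`exists_cycleDecomp_prod`). A
nontrivial shape is determined by its holonomy class and its weight. The classes of length `n`
therefore inject into the partitions of integers up to `2n` in `M` colours, of which there are at
most `exp (2nt + M π² / (6t))` for every `t > 0` (`card_partitions_le`). The best `t` gives the
exponent `2π √(M n / 3)`.

Lower bound. A tree of `a` triples gives a cycle of `2a + 1` points. An even pair gives two cycles
of `2b` and `2c` points at the cost of `b + c` triples. One more letter at a full point gives any
holonomy class. A cycle of `ℓ` points thus costs about `ℓ / 2` letters, and the parity of `ℓ`
doubles the number of colours: partitions of about `n` in `2M` colours yield distinct classes of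
length about `n` (`IsSufficientlyLarge.exists_of_parts`). The exponent is again `2π √(2M n / 6)`.

No asymptotic formula for partition numbers is needed. If the classes of length `n` numbered at most
`K exp (r √n)`, the generating function of these partitions at `exp (-t)` would have logarithm at
most about `r² / (4t)` as `t → 0`. Its Euler product has logarithm about `2M π² / (6t)`, so `r`
cannot be smaller than claimed (`card_mul_pi_sq_le`). -/

/-! ### Cycle decompositions of equivariant self-maps of `X × H` -/

section CycleDecomposition

variable {X H : Type*}

/-- The map `E` moves `z` along the points of `l`, one after the other, and then to `t`. -/
def PathTo (E : X × H → X × H) : X × H → List (X × H) → X × H → Prop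
  | z, [], t => E z = t
  | z, y :: l, t => E z = y ∧ PathTo E y l t

theorem path_append {E : X × H → X × H} {z y t : X × H} {l m : List (X × H)} :
    PathTo E z (l ++ y :: m) t ↔ PathTo E z l y ∧ PathTo E y m t := by
  induction l generalizing z with
  | nil => simp [PathTo]
  | cons x l ih => simp [PathTo, ih, and_assoc]

theorem PathTo.congr {E F : X × H → X × H} {z t : X × H} {l : List (X × H)} (h : PathTo E z l t)
    (hF : ∀ y ∈ z :: l, F y = E y) : PathTo F z l t := by
  induction l generalizing z with
  | nil => simpa [PathTo, hF z (by simp)] using h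
  | cons x l ih =>
    exact ⟨(hF z (by simp)).trans h.1, ih h.2 fun y hy => hF y (List.mem_cons_of_mem _ hy)⟩

theorem PathTo.congr_start {E F : X × H → X × H} {z y t : X × H} {l : List (X × H)}
    (h : PathTo E z l t) (hy : F y = E z) (hF : ∀ x ∈ l, F x = E x) : PathTo F y l t := by
  cases l with
  | nil => exact hy.trans h
  | cons x l => exact ⟨hy.trans h.1, h.2.congr hF⟩

/-- A cycle of an equivariant map: it runs through `head`, through the points of `tail`, and
comes back to the right translate of `head` by `hol`. -/
structure CycleBlock (X H : Type*) where
  /-- The starting point. -/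
  head : X × H
  /-- The other points. -/
  tail : List (X × H)
  /-- The holonomy. -/
  hol : H

namespace CycleBlock

/-- The points of `X` on a cycle. -/
def support (b : CycleBlock X H) : List X := b.head.1 :: b.tail.map Prod.fst

end CycleBlock

/-- The points of `X` on a list of cycles. -/
def blocksSupport (D : List (CycleBlock X H)) : List X := D.flatMap CycleBlock.support

@[simp] theorem blocksSupport_nil : blocksSupport ([] : List (CycleBlock X H)) = [] := rfl

@[simp] theorem blocksSupport_cons (b : CycleBlock X H) (D : List (CycleBlock X H)) :
    blocksSupport (b :: D) = b.support ++ blocksSupport D := rfl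

@[simp] theorem blocksSupport_append (D D' : List (CycleBlock X H)) :
    blocksSupport (D ++ D') = blocksSupport D ++ blocksSupport D' := by
  simp [blocksSupport]

theorem mem_blocksSupport {D : List (CycleBlock X H)} {x : X} :
    x ∈ blocksSupport D ↔ ∃ b ∈ D, x ∈ b.support := by
  simp [blocksSupport]

theorem List.Perm.blocksSupport {D D' : List (CycleBlock X H)} (h : D.Perm D') :
    (blocksSupport D).Perm (blocksSupport D') := h.flatMap_right _

theorem CycleBlock.fst_mem_support {b : CycleBlock X H} {y : X × H} (hy : y ∈ b.head :: b.tail) :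
    y.1 ∈ b.support := by
  rcases List.mem_cons.1 hy with rfl | hy
  · simp [CycleBlock.support]
  · exact List.mem_cons_of_mem _ (List.mem_map_of_mem hy)

variable [Group H]

/-- Right translation of the second coordinate of a point of `X × H`. -/
def rmul (z : X × H) (c : H) : X × H := (z.1, z.2 * c)

@[simp] theorem rmul_fst (z : X × H) (c : H) : (rmul z c).1 = z.1 := rfl

@[simp] theorem rmul_snd (z : X × H) (c : H) : (rmul z c).2 = z.2 * c := rfl

@[simp] theorem rmul_one (z : X × H) : rmul z 1 = z := by simp [rmul]

theorem rmul_rmul (z : X × H) (c d : H) : rmul (rmul z c) d = rmul z (c * d) := by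
  simp [rmul, mul_assoc]

theorem eq_rmul_of_fst_eq {z y : X × H} (h : z.1 = y.1) : z = rmul y (y.2⁻¹ * z.2) := by
  ext <;> simp [h]

/-- A self-map of `X × H` that commutes with the right translations by `H`. -/
def RightEquivariant (E : X × H → X × H) : Prop := ∀ z c, E (rmul z c) = rmul (E z) c

theorem RightEquivariant.comp {E F : X × H → X × H} (hE : RightEquivariant E)
    (hF : RightEquivariant F) : RightEquivariant (E ∘ F) := fun z c => by
  simp [hF z c, hE (F z) c]

theorem PathTo.rmul {E : X × H → X × H} (hE : RightEquivariant E) {z t : X × H}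
    {l : List (X × H)} (h : PathTo E z l t) (c : H) :
    PathTo E (rmul z c) (l.map (rmul · c)) (rmul t c) := by
  induction l generalizing z with
  | nil => exact (hE z c).trans (congrArg (_root_.rmul · c) h)
  | cons x l ih => exact ⟨(hE z c).trans (congrArg (_root_.rmul · c) h.1), ih h.2⟩

namespace CycleBlock

/-- The length (minus one) of a cycle and the conjugacy class of its holonomy. -/
def shape (b : CycleBlock X H) : ℕ × ConjClasses H := (b.tail.length, ConjClasses.mk b.hol)

/-- `E` runs through the cycle. -/
def IsCycleOf (b : CycleBlock X H) (E : X × H → X × H) : Prop :=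
  PathTo E b.head b.tail (rmul b.head b.hol)

end CycleBlock

/-- A decomposition of an equivariant map into disjoint cycles. -/
structure CycleDecomp (E : X × H → X × H) (D : List (CycleBlock X H)) : Prop where
  equivariant : RightEquivariant E
  nodup : (blocksSupport D).Nodup
  fixed : ∀ z : X × H, z.1 ∉ blocksSupport D → E z = z
  cycle : ∀ b ∈ D, b.IsCycleOf E

theorem CycleDecomp.perm {E : X × H → X × H} {D D' : List (CycleBlock X H)}
    (h : CycleDecomp E D) (hD : D.Perm D') : CycleDecomp E D' where
  equivariant := h.equivariant
  nodup := hD.blocksSupport.nodup_iff.1 h.nodup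
  fixed z hz := h.fixed z fun hz' => hz (hD.blocksSupport.mem_iff.1 hz')
  cycle b hb := h.cycle b (hD.mem_iff.2 hb)

/-- Surgery is local: changing the map only over the points of `B` leaves the cycles in `D` intact,
because the supports are disjoint. -/
theorem CycleDecomp.replace {E F : X × H → X × H} {B B' D : List (CycleBlock X H)}
    (h : CycleDecomp E (B ++ D)) (hF : RightEquivariant F)
    (hFE : ∀ z : X × H, z.1 ∉ blocksSupport B → F z = E z)
    (hsupp : (blocksSupport B').Perm (blocksSupport B))
    (hcyc : ∀ b ∈ B', b.IsCycleOf F) : CycleDecomp F (B' ++ D) := by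
  have hp : (blocksSupport (B' ++ D)).Perm (blocksSupport (B ++ D)) := by
    simpa using hsupp.append_right _
  refine ⟨hF, hp.nodup_iff.2 h.nodup, fun z hz => ?_, fun b hb => ?_⟩
  · rw [hp.mem_iff] at hz
    rw [hFE z fun hz' => hz (by simp [hz']), h.fixed z hz]
  · rcases List.mem_append.1 hb with hb | hb
    · exact hcyc b hb
    · refine PathTo.congr (h.cycle b (List.mem_append_right _ hb)) fun y hy => hFE y fun hy' => ?_
      have hd := h.nodup
      rw [blocksSupport_append] at hd
      exact (List.disjoint_of_nodup_append hd) hy'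
        (mem_blocksSupport.2 ⟨b, hb, CycleBlock.fst_mem_support hy⟩)

/-- A cycle may be entered at any of its points. Rotation keeps the holonomy, and translating the
start to second coordinate `1` conjugates it. -/
theorem CycleBlock.IsCycleOf.exists_start {E : X × H → X × H} (hE : RightEquivariant E)
    {b : CycleBlock X H} (hb : b.IsCycleOf E) {x : X} (hx : x ∈ b.support) :
    ∃ l h, CycleBlock.IsCycleOf ⟨(x, 1), l, h⟩ E ∧
      (CycleBlock.support ⟨(x, (1 : H)), l, h⟩).Perm b.support ∧
      CycleBlock.shape ⟨(x, (1 : H)), l, h⟩ = b.shape := by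
  obtain ⟨z, t, h⟩ := b
  suffices hs : ∃ y m, y.1 = x ∧ CycleBlock.IsCycleOf ⟨y, m, h⟩ E ∧
      (CycleBlock.support ⟨y, m, h⟩).Perm (CycleBlock.support ⟨z, t, h⟩) ∧
      m.length = t.length by
    obtain ⟨⟨_, g⟩, m, rfl, hm, hs, hl⟩ := hs
    refine ⟨m.map (rmul · g⁻¹), g * h * g⁻¹, ?_, ?_, ?_⟩
    · have := PathTo.rmul hE hm g⁻¹
      simpa [CycleBlock.IsCycleOf, rmul, mul_assoc] using this
    · simpa [CycleBlock.support, Function.comp_def] using hs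
    · simp only [CycleBlock.shape, List.length_map, hl, Prod.mk.injEq, true_and]
      exact ConjClasses.mk_eq_mk_iff_isConj.2 (isConj_iff.2 ⟨g⁻¹, by group⟩)
  rcases List.mem_cons.1 hx with rfl | hx
  · exact ⟨z, t, rfl, hb, .refl _, rfl⟩
  · obtain ⟨y, hy, rfl⟩ := List.mem_map.1 hx
    obtain ⟨l, m, rfl⟩ := List.append_of_mem hy
    have h12 := path_append.1 hb
    -- On the way back past the old start, the path is on the sheet translated by `h`.
    refine ⟨y, m ++ rmul z h :: l.map (rmul · h), rfl,
      path_append.2 ⟨h12.2, h12.1.rmul hE h⟩, ?_, by simp; omega⟩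
    simp only [CycleBlock.support, List.map_append, List.map_cons, List.map_map, rmul_fst,
      Function.comp_def]
    exact (List.perm_append_comm (l₁ := y.1 :: m.map Prod.fst)
      (l₂ := z.1 :: l.map Prod.fst)).trans (by simp)

/-- The shape of a cycle at a fixed point with trivial holonomy. -/
def trivialShape (H : Type*) [Group H] : ℕ × ConjClasses H := (0, ConjClasses.mk 1)

open scoped Classical in
/-- The multiset of the nontrivial shapes of a list of cycles. -/
noncomputable def shapes (D : List (CycleBlock X H)) : Multiset (ℕ × ConjClasses H) :=
  Multiset.filter (· ≠ trivialShape H) (D.map CycleBlock.shape : List (ℕ × ConjClasses H))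

theorem shapes_cons_of_trivial {b : CycleBlock X H} (D : List (CycleBlock X H))
    (hb : b.shape = trivialShape H) : shapes (b :: D) = shapes D := by
  simp [shapes, hb]

theorem shapes_cons_of_shape_eq {b b' : CycleBlock X H} (D : List (CycleBlock X H))
    (hb : b.shape = b'.shape) : shapes (b :: D) = shapes (b' :: D) := by
  simp [shapes, hb]

theorem shapes_perm {D D' : List (CycleBlock X H)} (h : D.Perm D') : shapes D = shapes D' := by
  simp only [shapes]
  rw [Multiset.coe_eq_coe.2 (h.map _)]

/-- Normal form before surgery at `x`: its cycle is brought to the front, or a trivial one-point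
cycle is added there, without disturbing `B`. -/
theorem CycleDecomp.exists_start {E : X × H → X × H} {B D : List (CycleBlock X H)}
    (h : CycleDecomp E (B ++ D)) {x : X} (hx : x ∉ blocksSupport B) :
    ∃ l k D', CycleDecomp E (⟨(x, 1), l, k⟩ :: (B ++ D')) ∧
      shapes (⟨(x, 1), l, k⟩ :: (B ++ D')) = shapes (B ++ D) := by
  by_cases hxD : x ∈ blocksSupport D
  · obtain ⟨b, hb, hxb⟩ := mem_blocksSupport.1 hxD
    obtain ⟨D₁, D₂, rfl⟩ := List.append_of_mem hb
    have hp : (B ++ (D₁ ++ b :: D₂)).Perm ([b] ++ (B ++ (D₁ ++ D₂))) := by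
      rw [← List.append_assoc]
      exact List.perm_middle.trans (by simp)
    have h' := h.perm hp
    obtain ⟨l, k, hc, hs, hsh⟩ := (h'.cycle b (by simp)).exists_start h.equivariant hxb
    refine ⟨l, k, D₁ ++ D₂, h'.replace (B' := [_]) h.equivariant (fun _ _ => rfl)
      (by simpa using hs) (by simpa using hc), ?_⟩
    rw [shapes_perm hp]
    exact shapes_cons_of_shape_eq _ hsh
  · have hx' : x ∉ blocksSupport (B ++ D) := by simp [hx, hxD]
    refine ⟨[], 1, D, ⟨h.equivariant, ?_, fun z hz => h.fixed z ?_, ?_⟩,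
      shapes_cons_of_trivial _ rfl⟩
    · rw [blocksSupport_cons]
      exact List.nodup_cons.2 ⟨hx', h.nodup⟩
    · rw [blocksSupport_cons] at hz
      exact fun hz' => hz (List.mem_append_right _ hz')
    · intro b hb
      rcases List.mem_cons.1 hb with rfl | hb
      · simpa [CycleBlock.IsCycleOf, PathTo] using h.fixed (x, 1) hx'
      · exact h.cycle b hb

end CycleDecomposition

section WeightBound

variable {X H : Type*} [Group H]

/-! ### Composing a decomposed map with a reflection -/

open scoped Classical in
/-- The weight of a cycle: its length minus one, plus one if the holonomy is nontrivial. -/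
noncomputable def shapeWeight (s : ℕ × ConjClasses H) : ℕ :=
  s.1 + if s.2 = ConjClasses.mk 1 then 0 else 1

/-- The total weight of a list of cycles. -/
noncomputable def totalWeight (D : List (CycleBlock X H)) : ℕ :=
  ((shapes D).map shapeWeight).sum

theorem totalWeight_cons (b : CycleBlock X H) (D : List (CycleBlock X H)) :
    totalWeight (b :: D) = shapeWeight b.shape + totalWeight D := by
  by_cases hb : b.shape = trivialShape H
  · simp [totalWeight, shapes_cons_of_trivial D hb, hb, shapeWeight, trivialShape]
  · simp [totalWeight, shapes, hb]

open scoped Classical in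
theorem shapeWeight_shape (b : CycleBlock X H) :
    shapeWeight b.shape = b.tail.length + if b.hol = 1 then 0 else 1 := by
  have h : ConjClasses.mk b.hol = ConjClasses.mk 1 ↔ b.hol = 1 := by
    rw [ConjClasses.mk_eq_mk_iff_isConj, isConj_comm, isConj_one_right]
  simp [shapeWeight, CycleBlock.shape, h]

/-- Started at `(u, a⁻¹)`, the new path joins the old one after one step and ends at `(u, h)`, which
is the start translated by `a * h`. -/
theorem CycleDecomp.comp_point {E P : X × H → X × H} {u : X} {a h : H} {l : List (X × H)}
    {D : List (CycleBlock X H)} (hD : CycleDecomp E (⟨(u, 1), l, h⟩ :: D))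
    (hP : RightEquivariant P) (hu : P (u, a⁻¹) = (u, 1)) (hfix : ∀ z : X × H, z.1 ≠ u → P z = z) :
    CycleDecomp (E ∘ P) (⟨(u, a⁻¹), l, a * h⟩ :: D) := by
  refine hD.replace (B := [_]) (B' := [_]) (hD.equivariant.comp hP) (fun z hz => ?_)
    (by simp [CycleBlock.support]) fun b hb => ?_
  · have hz : z.1 ≠ u := by rintro rfl; simp [CycleBlock.support] at hz
    simp [hfix z hz]
  · obtain rfl := List.mem_singleton.1 hb
    have h1 := hD.cycle _ List.mem_cons_self
    have hn := hD.nodup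
    simp only [CycleBlock.IsCycleOf] at h1 ⊢
    have : rmul (u, a⁻¹) (a * h) = rmul (u, (1 : H)) h := by simp [rmul]
    rw [this]
    refine h1.congr_start (by simp [hu]) fun x hx => ?_
    have hxu : x.1 ≠ u := by
      rintro rfl
      simp only [blocksSupport_cons, CycleBlock.support, List.cons_append, List.nodup_cons] at hn
      exact hn.1 (List.mem_append_left _ (List.mem_map_of_mem hx))
    simp [hfix x hxu]

theorem CycleDecomp.exists_comp_point {E P : X × H → X × H} {u : X} {a : H}
    {D : List (CycleBlock X H)} (hD : CycleDecomp E D) (hP : RightEquivariant P)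
    (hu : P (u, a⁻¹) = (u, 1)) (hfix : ∀ z : X × H, z.1 ≠ u → P z = z) :
    ∃ D', CycleDecomp (E ∘ P) D' ∧ totalWeight D' ≤ totalWeight D + 1 := by
  obtain ⟨l, k, D', h', hs⟩ := CycleDecomp.exists_start (B := []) hD (x := u) (by simp)
  refine ⟨_, h'.comp_point hP hu hfix, ?_⟩
  have : totalWeight D = totalWeight (⟨(u, 1), l, k⟩ :: D') :=
    congrArg (fun s => (s.map shapeWeight).sum) hs.symm
  simp only [this, List.nil_append, totalWeight_cons, shapeWeight_shape]
  split_ifs <;> omega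

/-- From `(a, 1)` the swap jumps onto the cycle of `b`. On returning over `b` at height `k` it jumps
back, and the cycle of `a` is traversed translated by `k`. -/
theorem CycleDecomp.merge {E P : X × H → X × H} {a b : X} {h k : H} {l m : List (X × H)}
    {D : List (CycleBlock X H)} (hD : CycleDecomp E (⟨(a, 1), l, h⟩ :: ⟨(b, 1), m, k⟩ :: D))
    (hP : RightEquivariant P) (ha : P (a, 1) = (b, 1)) (hb : P (b, 1) = (a, 1))
    (hfix : ∀ z : X × H, z.1 ≠ a → z.1 ≠ b → P z = z) :
    CycleDecomp (E ∘ P) (⟨(a, 1), m ++ rmul (b, 1) k :: l.map (rmul · k), h * k⟩ :: D) := by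
  have h1 := hD.cycle _ List.mem_cons_self
  have h2 := hD.cycle _ (List.mem_cons_of_mem _ List.mem_cons_self)
  have hn := hD.nodup
  simp only [blocksSupport_cons, CycleBlock.support, List.cons_append, List.nodup_cons,
    List.mem_append, List.mem_cons, not_or, List.nodup_append] at hn
  have hl : ∀ x ∈ l, P x = x := fun x hx => hfix x
    (by rintro rfl; exact hn.1.1 (List.mem_map_of_mem hx))
    (hn.2.2.2 _ (List.mem_map_of_mem hx) _ (.inl rfl))
  have hm : ∀ x ∈ m, P x = x := fun x hx => hfix x
    (by rintro rfl; exact hn.1.2.2.1 (List.mem_map_of_mem hx))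
    (by rintro rfl; exact hn.2.2.1.1.1 (List.mem_map_of_mem hx))
  refine hD.replace (B := [_, _]) (B' := [_]) (hD.equivariant.comp hP) (fun z hz => ?_) ?_
    fun c hc => ?_
  · simp only [blocksSupport_cons, CycleBlock.support, List.cons_append, List.mem_append,
      List.mem_cons, not_or] at hz
    simp [hfix z hz.1 hz.2.2.1]
  · simp only [blocksSupport_cons, CycleBlock.support, List.map_append, List.map_cons,
      List.map_map, Function.comp_def, rmul_fst, blocksSupport_nil, List.append_nil,
      List.cons_append]
    refine List.Perm.cons _ ?_
    exact List.perm_middle.trans ((List.perm_append_comm.cons _).trans List.perm_middle.symm)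
  · obtain rfl := List.mem_singleton.1 hc
    refine path_append.2 ⟨PathTo.congr_start h2 (by simp [ha]) fun x hx => by simp [hm x hx], ?_⟩
    have h3 := PathTo.rmul hD.equivariant h1 k
    rw [rmul_rmul] at h3
    refine h3.congr_start (by simp [hP _ k, hb]) fun x hx => ?_
    obtain ⟨y, hy, rfl⟩ := List.mem_map.1 hx
    simp [hP y k, hl y hy]

/-- The two jumps cut the cycle at `a` and `b`. The holonomies `g` and `g⁻¹ * h` of the pieces
multiply to the old one. -/
theorem CycleDecomp.split {E P : X × H → X × H} {a b : X} {g h : H} {l m : List (X × H)}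
    {D : List (CycleBlock X H)} (hD : CycleDecomp E (⟨(a, 1), l ++ (b, g) :: m, h⟩ :: D))
    (hP : RightEquivariant P) (ha : P (a, 1) = (b, 1)) (hb : P (b, 1) = (a, 1))
    (hfix : ∀ z : X × H, z.1 ≠ a → z.1 ≠ b → P z = z) :
    CycleDecomp (E ∘ P) (⟨(b, 1), l, g⟩ :: ⟨(a, g), m, g⁻¹ * h⟩ :: D) := by
  have h1 := path_append.1 (hD.cycle _ List.mem_cons_self)
  have hn := hD.nodup
  simp only [blocksSupport_cons, CycleBlock.support, List.cons_append, List.nodup_cons,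
    List.mem_append, List.mem_cons, not_or, List.nodup_append, List.map_append, List.map_cons]
    at hn
  have hl : ∀ x ∈ l, P x = x := fun x hx => hfix x
    (by rintro rfl; exact hn.1.1.1 (List.mem_map_of_mem hx))
    (hn.2.1.2.2 _ (List.mem_map_of_mem hx) _ (.inl rfl))
  have hm : ∀ x ∈ m, P x = x := fun x hx => hfix x
    (by rintro rfl; exact hn.1.1.2.2 (List.mem_map_of_mem hx))
    (by rintro rfl; exact hn.2.1.2.1.1 (List.mem_map_of_mem hx))
  refine hD.replace (B := [_]) (B' := [_, _]) (hD.equivariant.comp hP) (fun z hz => ?_) ?_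
    fun c hc => ?_
  · simp only [blocksSupport_cons, CycleBlock.support, List.cons_append, List.mem_append,
      List.mem_cons, not_or, List.map_append, List.map_cons] at hz
    simp [hfix z hz.1 hz.2.1.2.1]
  · simp only [blocksSupport_cons, CycleBlock.support, List.map_append, List.map_cons,
      blocksSupport_nil, List.append_nil, List.cons_append]
    exact (List.perm_middle.cons _).trans ((List.Perm.swap _ _ _).trans
      (List.perm_middle.symm.cons _))
  · have hba : P (b, g) = (a, g) := by simpa [hb, rmul] using hP (b, 1) g
    have hab : P (a, g) = (b, g) := by simpa [ha, rmul] using hP (a, 1) g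
    simp only [List.mem_cons, List.not_mem_nil, or_false] at hc
    rcases hc with rfl | rfl
    · have := h1.1.congr_start (F := E ∘ P) (y := (b, 1)) (by simp [hb])
        fun x hx => by simp [hl x hx]
      simpa [CycleBlock.IsCycleOf, rmul] using this
    · have := h1.2.congr_start (F := E ∘ P) (y := (a, g)) (by simp [hab])
        fun x hx => by simp [hm x hx]
      simpa [CycleBlock.IsCycleOf, rmul] using this

/-- A split lowers the sum of `ℓ - 1` by one and creates at most two nontrivial holonomies. A merge
raises that sum by one, but `h * k ≠ 1` forces `h ≠ 1` or `k ≠ 1`. -/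
theorem CycleDecomp.exists_comp_swap {E P : X × H → X × H} {a b : X}
    {D : List (CycleBlock X H)} (hD : CycleDecomp E D) (hab : a ≠ b) (hP : RightEquivariant P)
    (ha : P (a, 1) = (b, 1)) (hb : P (b, 1) = (a, 1))
    (hfix : ∀ z : X × H, z.1 ≠ a → z.1 ≠ b → P z = z) :
    ∃ D', CycleDecomp (E ∘ P) D' ∧ totalWeight D' ≤ totalWeight D + 1 := by
  obtain ⟨l, h, D₁, h₁, hs₁⟩ := CycleDecomp.exists_start (B := []) hD (x := a) (by simp)
  have hw₁ : totalWeight D = totalWeight (⟨(a, 1), l, h⟩ :: D₁) :=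
    congrArg (fun s => (s.map shapeWeight).sum) hs₁.symm
  by_cases hbl : b ∈ l.map Prod.fst
  · obtain ⟨⟨_, g⟩, hg, rfl⟩ := List.mem_map.1 hbl
    obtain ⟨l, m, rfl⟩ := List.append_of_mem hg
    refine ⟨_, h₁.split hP ha hb hfix, ?_⟩
    simp only [hw₁, List.nil_append, totalWeight_cons, shapeWeight_shape, List.length_append,
      List.length_cons]
    by_cases hg1 : g = 1
    · simp only [hg1, inv_one, one_mul]
      split_ifs <;> omega
    · by_cases hh : h = 1
      · split_ifs <;> omega
      · split_ifs <;> omega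
  · obtain ⟨m, k, D₂, h₂, hs₂⟩ := CycleDecomp.exists_start (B := [⟨(a, 1), l, h⟩]) h₁ (x := b)
      (by
        simp only [blocksSupport_cons, CycleBlock.support, blocksSupport_nil, List.append_nil,
          List.mem_cons, not_or]
        exact ⟨hab.symm, hbl⟩)
    have hw₂ : totalWeight (⟨(a, 1), l, h⟩ :: D₁) =
        totalWeight (⟨(b, 1), m, k⟩ :: ⟨(a, 1), l, h⟩ :: D₂) :=
      congrArg (fun s => (s.map shapeWeight).sum) hs₂.symm
    have h₃ : CycleDecomp E (⟨(a, 1), l, h⟩ :: ⟨(b, 1), m, k⟩ :: D₂) := h₂.perm (.swap _ _ _)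
    refine ⟨_, h₃.merge hP ha hb hfix, ?_⟩
    rw [hw₁, hw₂]
    simp only [totalWeight_cons, shapeWeight_shape, List.length_append, List.length_cons,
      List.length_map]
    have hhk : h = 1 → k = 1 → h * k = 1 := by rintro rfl rfl; exact one_mul 1
    split_ifs <;> first | omega | tauto

end WeightBound

section SwapAction

variable {X H : Type*}

open scoped Classical in
/-- The map of `X × H` that swaps two points of `X`. -/
noncomputable def swapAct (H : Type*) {X : Type*} (a b : X) (z : X × H) : X × H :=
  (Equiv.swap a b z.1, z.2)

theorem swapAct_left (a b : X) (g : H) : swapAct H a b (a, g) = (b, g) := by simp [swapAct]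

theorem swapAct_right (a b : X) (g : H) : swapAct H a b (b, g) = (a, g) := by simp [swapAct]

theorem swapAct_of_ne {a b : X} {z : X × H} (ha : z.1 ≠ a) (hb : z.1 ≠ b) :
    swapAct H a b z = z := by
  classical
  exact Prod.ext (Equiv.swap_apply_of_ne_of_ne ha hb) rfl

end SwapAction

section WreathAction

variable {X H : Type*} [Group H]

/-! ### The action of the wreath product on `X × H` -/

/-- The action of `H ≀_X Alt(X)` on `X × H`. -/
def wreathAct (w : AltWreath H X) (z : X × H) : X × H :=
  ((w.right : Equiv.Perm X) z.1, (w.left : X → H) ((w.right : Equiv.Perm X) z.1) * z.2)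

theorem wreathAct_one : wreathAct (1 : AltWreath H X) = id := by
  ext z <;> simp [wreathAct]

theorem wreathAct_mul (v w : AltWreath H X) :
    wreathAct (v * w) = wreathAct v ∘ wreathAct w := by
  ext z <;> simp [wreathAct, permFinFun, mul_assoc]

theorem wreathAct_injective : Function.Injective (wreathAct : AltWreath H X → X × H → X × H) := by
  intro v w h
  have hr : v.right = w.right := by
    ext x
    exact congrArg Prod.fst (congrFun h (x, 1))
  refine SemidirectProduct.ext ?_ hr
  ext x
  have := congrArg Prod.snd (congrFun h ((v.right : Equiv.Perm X)⁻¹ x, 1))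
  simpa [wreathAct, ← hr] using this

theorem rightEquivariant_wreathAct (w : AltWreath H X) : RightEquivariant (wreathAct w) :=
  fun z c => by ext <;> simp [wreathAct, mul_assoc]

theorem rightEquivariant_swapAct (a b : X) : RightEquivariant (swapAct H a b) :=
  fun z c => by ext <;> simp [swapAct]

theorem IsThreeCyc.wreathAct {w : AltWreath H X} {x y z : X} (h : IsThreeCyc w x y z) :
    wreathAct w = swapAct H x y ∘ swapAct H y z := by
  ext p <;> simp [_root_.wreathAct, swapAct, h.2.2.2.1, h.2.2.2.2]

theorem IsPoint.wreathAct_self {w : AltWreath H X} {u : X} {a : H} (h : IsPoint w u a) (g : H) :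
    wreathAct w (u, g) = (u, a * g) := by
  simp [wreathAct, h.1, h.2]

theorem IsPoint.wreathAct_of_ne {w : AltWreath H X} {u : X} {a : H} (h : IsPoint w u a)
    {z : X × H} (hz : z.1 ≠ u) : wreathAct w z = z := by
  ext <;> simp [wreathAct, h.1, h.2, hz]

theorem IsPoint.inv {w : AltWreath H X} {u : X} {a : H} (h : IsPoint w u a) :
    IsPoint w⁻¹ u a⁻¹ := by
  classical
  refine ⟨by simp [h.1], ?_⟩
  rw [SemidirectProduct.inv_left, h.1]
  simp [h.2, Pi.mulSingle_inv]

theorem IsThreeCyc.inv {w : AltWreath H X} {x y z : X} (h : IsThreeCyc w x y z) :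
    IsThreeCyc w⁻¹ z y x := by
  classical
  obtain ⟨hxy, hyz, hxz, hl, hr⟩ := h
  refine ⟨hyz.symm, hxy.symm, hxz.symm, by simp [hl], ?_⟩
  rw [SemidirectProduct.inv_right, Subgroup.coe_inv, hr, mul_inv_rev, Equiv.swap_inv,
    Equiv.swap_inv, Equiv.swap_comm z y, Equiv.swap_comm y x]

/-- Words in `S ∪ S⁻¹`. -/
def IsWord {G : Type*} [Group G] (S : Set G) (l : List G) : Prop := ∀ s ∈ l, s ∈ S ∨ s⁻¹ ∈ S

theorem isPoint_or_isThreeCyc {S : Set (AltWreath H X)}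
    (hS : S ⊆ pointGens H X ∪ threeCycGens H X) {s : AltWreath H X} (hs : s ∈ S ∨ s⁻¹ ∈ S) :
    (∃ u a, IsPoint s u a) ∨ ∃ x y z, IsThreeCyc s x y z := by
  rcases hs with hs | hs
  · rcases hS hs with ⟨u, a, -, h⟩ | ⟨x, y, z, h⟩
    · exact .inl ⟨u, a, h⟩
    · exact .inr ⟨x, y, z, h⟩
  · rcases hS hs with ⟨u, a, -, h⟩ | ⟨x, y, z, h⟩
    · exact .inl ⟨u, a⁻¹, by simpa using h.inv⟩
    · exact .inr ⟨z, y, x, by simpa using h.inv⟩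

/-- Letters are added on the right, that is, by precomposition. The factor `2` comes from the
3-cycles, each being two swaps. -/
theorem exists_cycleDecomp_prod {S : Set (AltWreath H X)}
    (hS : S ⊆ pointGens H X ∪ threeCycGens H X) (l : List (AltWreath H X)) (hl : IsWord S l) :
    ∃ D, CycleDecomp (wreathAct l.prod) D ∧ totalWeight D ≤ 2 * l.length := by
  induction l using List.reverseRecOn with
  | nil =>
    refine ⟨[], ⟨rightEquivariant_wreathAct _, by simp, fun z _ => ?_, by simp⟩, ?_⟩
    · simp [wreathAct_one]
    · simp [totalWeight, shapes]
  | append_singleton l s ih =>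
    obtain ⟨D, hD, hw⟩ := ih fun t ht => hl t (by simp [ht])
    rw [List.prod_append, List.prod_singleton, wreathAct_mul]
    simp only [List.length_append, List.length_singleton]
    rcases isPoint_or_isThreeCyc hS (hl s (by simp)) with ⟨u, a, h⟩ | ⟨x, y, z, h⟩
    · obtain ⟨D', hD', hw'⟩ := hD.exists_comp_point (rightEquivariant_wreathAct s)
        (u := u) (a := a) (by simp [h.wreathAct_self]) fun z hz => h.wreathAct_of_ne hz
      exact ⟨D', hD', by omega⟩
    · obtain ⟨D₁, hD₁, hw₁⟩ := hD.exists_comp_swap h.1 (rightEquivariant_swapAct x y)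
        (swapAct_left _ _ _) (swapAct_right _ _ _) fun _ => swapAct_of_ne
      obtain ⟨D₂, hD₂, hw₂⟩ := hD₁.exists_comp_swap h.2.1 (rightEquivariant_swapAct y z)
        (swapAct_left _ _ _) (swapAct_right _ _ _) fun _ => swapAct_of_ne
      rw [h.wreathAct]
      exact ⟨D₂, hD₂, by omega⟩

end WreathAction

/-! ### Iterates and images of cycles -/

section ShapeInvariance

variable {X H : Type*}

theorem blocksSupport_sublist {D D' : List (CycleBlock X H)} (h : D.Sublist D') :
    (blocksSupport D).Sublist (blocksSupport D') := h.flatMap _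

theorem pathTo_iterate {E : X × H → X × H} {z t : X × H} {l : List (X × H)} (h : PathTo E z l t) :
    (∀ (j : ℕ) (hj : j < l.length), E^[j + 1] z = l[j]) ∧ E^[l.length + 1] z = t := by
  induction l generalizing z with
  | nil => simpa [PathTo] using h
  | cons y l ih =>
    obtain ⟨h1, h2⟩ := ih h.2
    refine ⟨fun j hj => ?_, ?_⟩
    · cases j with
      | zero => simpa using h.1
      | succ j =>
        rw [Function.iterate_succ_apply, h.1]
        simpa using h1 j (by simpa using hj)
    · rw [List.length_cons, Function.iterate_succ_apply, h.1, h2]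

/-- The image of a cycle under a map of `X × H`. -/
def CycleBlock.map (K : X × H → X × H) (b : CycleBlock X H) : CycleBlock X H :=
  ⟨K b.head, b.tail.map K, b.hol⟩

theorem PathTo.map {E F K : X × H → X × H} {z t : X × H} {l : List (X × H)}
    (hK : ∀ z, F (K z) = K (E z)) (h : PathTo E z l t) : PathTo F (K z) (l.map K) (K t) := by
  induction l generalizing z with
  | nil => exact (hK z).trans (congrArg K h)
  | cons y l ih => exact ⟨(hK z).trans (congrArg K h.1), ih h.2⟩

theorem blocksSupport_map {K : X × H → X × H} {σ : X → X} (hK : ∀ z, (K z).1 = σ z.1)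
    (D : List (CycleBlock X H)) : blocksSupport (D.map (CycleBlock.map K)) =
      (blocksSupport D).map σ := by
  induction D with
  | nil => rfl
  | cons b D ih =>
    simp [ih, CycleBlock.map, CycleBlock.support, hK]

/-- The points of `X × H` on a list of cycles. -/
def blocksPoints (D : List (CycleBlock X H)) : List (X × H) := D.flatMap fun b => b.head :: b.tail

theorem map_fst_blocksPoints (D : List (CycleBlock X H)) :
    (blocksPoints D).map Prod.fst = blocksSupport D := by
  induction D with
  | nil => rfl
  | cons b D ih => simpa [blocksPoints, CycleBlock.support] using ih

theorem map_eq_of_map_blocksPoints {K : X × H → X × H} {D D' : List (CycleBlock X H)}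
    (h : List.Forall₂ (fun b c => c.tail.length = b.tail.length ∧ c.hol = b.hol) D D')
    (hK : (blocksPoints D).map K = blocksPoints D') : D' = D.map (CycleBlock.map K) := by
  induction h with
  | nil => rfl
  | @cons b c D D' hbc _ ih =>
    simp only [blocksPoints, List.flatMap_cons, List.map_append, List.map_cons,
      List.cons_append, List.cons.injEq] at hK
    obtain ⟨h1, h2⟩ := List.append_inj hK.2 (by simp [hbc.1])
    rw [List.map_cons, ← ih h2]
    obtain ⟨z, l, k⟩ := c
    simp_all [CycleBlock.map]

theorem PathTo.intertwine {E F K : X × H → X × H} {z t : X × H} {l : List (X × H)}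
    (h : PathTo E z l t) (h' : PathTo F (K z) (l.map K) (K t)) :
    ∀ y ∈ z :: l, F (K y) = K (E y) := by
  induction l generalizing z with
  | nil =>
    intro y hy
    obtain rfl := List.mem_singleton.1 hy
    exact h'.trans (congrArg K h.symm)
  | cons x l ih =>
    intro y hy
    rcases List.mem_cons.1 hy with rfl | hy
    · exact h'.1.trans (congrArg K h.1.symm)
    · exact ih h.2 h'.2 y hy

variable [Group H]

/-! ### The shapes of a decomposition determine the map up to conjugation, and conversely -/

/-- The point `x` lies on a cycle of the given shape. -/
def HasShape (E : X × H → X × H) (x : X) (s : ℕ × ConjClasses H) : Prop :=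
  ∃ h : H, ConjClasses.mk h = s.2 ∧ E^[s.1 + 1] (x, 1) = (x, h) ∧
    ∀ j < s.1, (E^[j + 1] (x, 1)).1 ≠ x

/-- The number `s.1 + 1` is the first return time to the fibre over `x`, and the holonomy is read
off at that time. -/
theorem HasShape.unique {E : X × H → X × H} {x : X} {s t : ℕ × ConjClasses H}
    (hs : HasShape E x s) (ht : HasShape E x t) : s = t := by
  obtain ⟨h, hh, h1, h2⟩ := hs
  obtain ⟨k, hk, k1, k2⟩ := ht
  rcases lt_trichotomy s.1 t.1 with hlt | heq | hlt
  · exact absurd (congrArg Prod.fst h1) (k2 _ hlt)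
  · rw [heq, k1] at h1
    refine Prod.ext heq ?_
    rw [← hh, ← hk, (Prod.mk.inj h1).2]
  · exact absurd (congrArg Prod.fst k1) (h2 _ hlt)

theorem CycleDecomp.support_nodup {E : X × H → X × H} {D : List (CycleBlock X H)}
    (hD : CycleDecomp E D) {b : CycleBlock X H} (hb : b ∈ D) : b.support.Nodup :=
  (List.nodup_flatMap.1 hD.nodup).1 b hb

theorem CycleDecomp.hasShape {E : X × H → X × H} {D : List (CycleBlock X H)}
    (hD : CycleDecomp E D) {b : CycleBlock X H} (hb : b ∈ D) {x : X} (hx : x ∈ b.support) :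
    HasShape E x b.shape := by
  obtain ⟨l, h, hc, hs, hsh⟩ := (hD.cycle b hb).exists_start hD.equivariant hx
  rw [← hsh]
  obtain ⟨h1, h2⟩ := pathTo_iterate hc
  refine ⟨h, rfl, by simpa [CycleBlock.shape, rmul] using h2, fun j hj => ?_⟩
  have hn := hs.nodup_iff.2 (hD.support_nodup hb)
  rw [h1 j hj]
  intro hj'
  exact (List.nodup_cons.1 hn).1 (List.mem_map.2 ⟨_, List.getElem_mem hj, hj'⟩)

theorem CycleDecomp.hasShape_trivial {E : X × H → X × H} {D : List (CycleBlock X H)}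
    (hD : CycleDecomp E D) {x : X} (hx : x ∉ blocksSupport D) :
    HasShape E x (trivialShape H) :=
  ⟨1, rfl, by simpa [trivialShape] using hD.fixed (x, 1) hx, by simp [trivialShape]⟩

open scoped Classical in
theorem CycleDecomp.mem_support_filter {E : X × H → X × H} {D : List (CycleBlock X H)}
    (hD : CycleDecomp E D) {s : ℕ × ConjClasses H} (hs : s ≠ trivialShape H) {x : X} :
    x ∈ blocksSupport (D.filter (·.shape = s)) ↔ HasShape E x s := by
  constructor
  · intro hx
    obtain ⟨b, hb, hxb⟩ := mem_blocksSupport.1 hx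
    obtain ⟨hbD, rfl⟩ : b ∈ D ∧ b.shape = s := by simpa using hb
    exact hD.hasShape hbD hxb
  · intro hx
    by_cases hxD : x ∈ blocksSupport D
    · obtain ⟨b, hb, hxb⟩ := mem_blocksSupport.1 hxD
      exact mem_blocksSupport.2 ⟨b, by simpa [hb] using (hD.hasShape hb hxb).unique hx, hxb⟩
    · exact absurd (hx.unique (hD.hasShape_trivial hxD)) hs

open scoped Classical in
theorem length_support_filter (D : List (CycleBlock X H)) (s : ℕ × ConjClasses H) :
    (blocksSupport (D.filter (·.shape = s))).length =
      (s.1 + 1) * Multiset.count s (D.map CycleBlock.shape : List (ℕ × ConjClasses H)) := by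
  induction D with
  | nil => simp
  | cons b D ih =>
    rw [List.map_cons, ← Multiset.cons_coe]
    by_cases hb : b.shape = s
    · rw [List.filter_cons_of_pos (by simpa using hb), blocksSupport_cons, List.length_append, ih,
        hb, Multiset.count_cons_self, ← hb]
      simp only [CycleBlock.support, CycleBlock.shape, List.length_cons, List.length_map]
      ring
    · rw [List.filter_cons_of_neg (by simpa using hb), ih, Multiset.count_cons_of_ne (Ne.symm hb)]

/-- By `HasShape`, the points lying on cycles of a nontrivial shape `s` depend on `E` alone. Their
number is `s.1 + 1` times the multiplicity of `s`. -/
theorem CycleDecomp.shapes_unique {E : X × H → X × H} {D D' : List (CycleBlock X H)}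
    (hD : CycleDecomp E D) (hD' : CycleDecomp E D') : shapes D = shapes D' := by
  classical
  ext s
  by_cases hs : s = trivialShape H
  · simp [shapes, hs]
  · have hn : ∀ {D : List (CycleBlock X H)}, CycleDecomp E D →
        (blocksSupport (D.filter (·.shape = s))).Nodup := fun {D} hD =>
      hD.nodup.sublist (blocksSupport_sublist List.filter_sublist)
    have hp := (List.perm_ext_iff_of_nodup (hn hD) (hn hD')).2 fun x => by
      rw [hD.mem_support_filter hs, hD'.mem_support_filter hs]
    have hl := hp.length_eq
    rw [length_support_filter, length_support_filter] at hl
    simp only [shapes]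
    rw [Multiset.count_filter_of_pos (p := (· ≠ trivialShape H)) hs,
      Multiset.count_filter_of_pos (p := (· ≠ trivialShape H)) hs]
    exact Nat.eq_of_mul_eq_mul_left (Nat.succ_pos _) hl

theorem shapes_map (K : X × H → X × H) (D : List (CycleBlock X H)) :
    shapes (D.map (CycleBlock.map K)) = shapes D := by
  have : CycleBlock.shape ∘ CycleBlock.map K = (CycleBlock.shape : CycleBlock X H → _) := by
    ext b <;> simp [CycleBlock.map, CycleBlock.shape]
  rw [shapes, shapes, List.map_map, this]

theorem CycleDecomp.map_of_conj {k v w : AltWreath H X} {D : List (CycleBlock X H)}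
    (hD : CycleDecomp (wreathAct v) D) (h : w * k = k * v) :
    CycleDecomp (wreathAct w) (D.map (CycleBlock.map (wreathAct k))) := by
  have hK : ∀ z, wreathAct w (wreathAct k z) = wreathAct k (wreathAct v z) := fun z => by
    simpa [wreathAct_mul] using congrFun (congrArg wreathAct h) z
  have hs := blocksSupport_map (K := wreathAct k) (σ := (k.right : Equiv.Perm X))
    (fun _ => rfl) D
  refine ⟨rightEquivariant_wreathAct w, ?_, fun z hz => ?_, fun b hb => ?_⟩
  · rw [hs]
    exact hD.nodup.map (Equiv.injective _)
  · have hz' : wreathAct k (wreathAct k⁻¹ z) = z := by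
      rw [← Function.comp_apply (f := wreathAct k), ← wreathAct_mul, mul_inv_cancel,
        wreathAct_one, id]
    rw [← hz', hK, hD.fixed]
    intro hmem
    rw [hs, ← hz'] at hz
    exact hz (List.mem_map_of_mem hmem)
  · obtain ⟨b, hbD, rfl⟩ := List.mem_map.1 hb
    have := (hD.cycle b hbD).map hK
    rwa [rightEquivariant_wreathAct k] at this

theorem CycleDecomp.shapes_eq_of_isConj {v w : AltWreath H X} {D D' : List (CycleBlock X H)}
    (hD : CycleDecomp (wreathAct v) D) (hD' : CycleDecomp (wreathAct w) D') (h : IsConj v w) :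
    shapes D = shapes D' := by
  obtain ⟨k, rfl⟩ := isConj_iff.1 h
  rw [← shapes_map (wreathAct k) D]
  exact (hD.map_of_conj (by group)).shapes_unique hD'

/-! ### Transitivity of the finitary wreath product -/

theorem exists_swaps_map_eq (l l' : List X) (hl : l.Nodup) (hl' : l'.Nodup)
    (hlen : l.length = l'.length) [DecidableEq X] :
    ∃ t : List (Equiv.Perm X), (∀ τ ∈ t, τ.IsSwap) ∧ l.map t.prod = l' := by
  induction l generalizing l' with
  | nil => exact ⟨[], by simp, by simpa [eq_comm] using hlen⟩
  | cons x l ih =>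
    obtain _ | ⟨y, l'⟩ := l'
    · simp at hlen
    · rw [List.nodup_cons] at hl hl'
      obtain ⟨t, ht, rfl⟩ := ih l' hl.2 hl'.2 (by simpa using hlen)
      by_cases hxy : t.prod x = y
      · exact ⟨t, ht, by simp [hxy]⟩
      · refine ⟨Equiv.swap (t.prod x) y :: t, ?_, ?_⟩
        · intro τ hτ
          rcases List.mem_cons.1 hτ with rfl | hτ
          · exact ⟨_, _, hxy, rfl⟩
          · exact ht τ hτ
        · simp only [List.map_cons, List.prod_cons, Equiv.Perm.mul_apply, Equiv.swap_apply_left,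
            List.cons.injEq, true_and, List.map_inj_left]
          intro z hz
          refine Equiv.swap_apply_of_ne_of_ne ?_ ?_
          · rw [Ne, t.prod.apply_eq_iff_eq]
            rintro rfl
            exact hl.1 hz
          · rintro rfl
            exact hl'.1 (List.mem_map_of_mem hz)

/-- An odd permutation is corrected by a swap of two points outside `l`, which exist because `X` is
infinite. -/
theorem exists_finAlt_map_eq [Infinite X] (l l' : List X) (hl : l.Nodup) (hl' : l'.Nodup)
    (hlen : l.length = l'.length) : ∃ σ ∈ finAlt X, l.map σ = l' := by
  classical
  obtain ⟨t, ht, rfl⟩ := exists_swaps_map_eq l l' hl hl' hlen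
  rcases Nat.even_or_odd t.length with he | ho
  · exact ⟨t.prod, ⟨t, by convert ht, he, rfl⟩, rfl⟩
  · obtain ⟨p, hp⟩ := Infinite.exists_notMem_finset l.toFinset
    obtain ⟨q, hq⟩ := Infinite.exists_notMem_finset (insert p l.toFinset)
    simp only [Finset.mem_insert, List.mem_toFinset, not_or] at hp hq
    refine ⟨(t ++ [Equiv.swap p q]).prod, ⟨_, ?_, ?_, rfl⟩, ?_⟩
    · intro τ hτ
      rcases List.mem_append.1 hτ with hτ | hτ
      · convert ht τ hτ
      · rw [List.mem_singleton.1 hτ]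
        exact ⟨p, q, Ne.symm hq.1, by congr!⟩
    · rw [List.length_append]
      exact ho.add_one
    · simp only [List.prod_append, List.prod_singleton, List.map_inj_left, Equiv.Perm.mul_apply]
      intro z hz
      rw [Equiv.swap_apply_of_ne_of_ne]
      · rintro rfl; exact hp hz
      · rintro rfl; exact hq.2 hz

theorem exists_finFun_eq (l : List (X × H)) (hl : (l.map Prod.fst).Nodup) :
    ∃ φ ∈ finFun H X, ∀ z ∈ l, φ z.1 = z.2 := by
  classical
  induction l with
  | nil => exact ⟨1, one_mem _, by simp⟩
  | cons y l ih =>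
    rw [List.map_cons, List.nodup_cons] at hl
    obtain ⟨φ, hφ, h⟩ := ih hl.2
    refine ⟨Function.update φ y.1 y.2, ?_, ?_⟩
    · refine Set.Finite.subset (Set.Finite.insert y.1 hφ) fun x hx => ?_
      by_cases hxy : x = y.1
      · exact .inl hxy
      · exact .inr (by simpa [hxy] using hx)
    · intro z hz
      rcases List.mem_cons.1 hz with rfl | hz
      · simp
      · rw [Function.update_of_ne, h z hz]
        intro he
        exact hl.1 (he ▸ List.mem_map_of_mem hz)

theorem exists_wreathAct_map_eq [Infinite X] (l l' : List (X × H)) (hl : (l.map Prod.fst).Nodup)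
    (hl' : (l'.map Prod.fst).Nodup) (hlen : l.length = l'.length) :
    ∃ k : AltWreath H X, l.map (wreathAct k) = l' := by
  obtain ⟨σ, hσ, hσl⟩ := exists_finAlt_map_eq _ _ hl hl' (by simpa using hlen)
  obtain ⟨φ, hφ, hφl⟩ := exists_finFun_eq
    (List.zipWith (fun p q : X × H => (q.1, q.2 * p.2⁻¹)) l l') (by
      convert hl' using 1
      refine List.ext_getElem (by simp [hlen]) fun i h1 h2 => by simp)
  refine ⟨⟨⟨φ, hφ⟩, ⟨σ, hσ⟩⟩, List.ext_getElem (by simp [hlen]) fun i h1 h2 => ?_⟩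
  have hi : i < l.length := by simpa using h1
  have e1 : σ l[i].1 = l'[i].1 := by
    have := List.getElem_of_eq hσl (i := i) (by simpa using hi)
    simpa using this
  have e2 : φ l'[i].1 = l'[i].2 * l[i].2⁻¹ :=
    hφl (l'[i].1, l'[i].2 * l[i].2⁻¹) (List.mem_iff_getElem.2 ⟨i, by simp [hi, h2], by simp⟩)
  simp only [List.getElem_map]
  ext <;> simp [wreathAct, e1, e2]

/-! ### Conjugacy of elements with the same shapes -/

theorem CycleDecomp.exists_shapes_eq_map {E : X × H → X × H} {D : List (CycleBlock X H)}
    (hD : CycleDecomp E D) :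
    ∃ D₀, CycleDecomp E D₀ ∧ shapes D = (D₀.map CycleBlock.shape : List (ℕ × ConjClasses H)) := by
  classical
  refine ⟨D.filter (·.shape ≠ trivialShape H), ⟨hD.equivariant,
    hD.nodup.sublist (blocksSupport_sublist List.filter_sublist), fun z hz => ?_,
    fun b hb => hD.cycle b (List.mem_of_mem_filter hb)⟩, ?_⟩
  · by_cases hzD : z.1 ∈ blocksSupport D
    · obtain ⟨b, hb, hzb⟩ := mem_blocksSupport.1 hzD
      have hbt : b.shape = trivialShape H := by
        by_contra hne
        exact hz (mem_blocksSupport.2 ⟨b, by simpa [hb] using hne, hzb⟩)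
      obtain ⟨y, t, h⟩ := b
      simp only [CycleBlock.shape, trivialShape, Prod.mk.injEq, List.length_eq_zero_iff] at hbt
      obtain ⟨rfl, hh⟩ := hbt
      obtain rfl : h = 1 := by
        rwa [ConjClasses.mk_eq_mk_iff_isConj, isConj_comm, isConj_one_right] at hh
      have hy : E y = y := by simpa [CycleBlock.IsCycleOf, PathTo] using hD.cycle _ hb
      have hzy : z.1 = y.1 := by simpa [CycleBlock.support] using hzb
      rw [eq_rmul_of_fst_eq hzy, hD.equivariant, hy]
    · exact hD.fixed z hzD
  · simp only [shapes, Multiset.filter_coe, List.filter_map, Function.comp_def]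

/-- Translating the start of a cycle conjugates its holonomy, so conjugate holonomies can be made
equal. -/
theorem CycleDecomp.exists_hol_eq {E : X × H → X × H} {D D' : List (CycleBlock X H)}
    (hD : CycleDecomp E D) (h : List.Forall₂ (fun b c => c.shape = b.shape) D' D) :
    ∃ D₁, CycleDecomp E D₁ ∧
      List.Forall₂ (fun b c => c.tail.length = b.tail.length ∧ c.hol = b.hol) D' D₁ := by
  suffices hs : ∃ D₁, blocksSupport D₁ = blocksSupport D ∧ (∀ b ∈ D₁, b.IsCycleOf E) ∧
      List.Forall₂ (fun b c => c.tail.length = b.tail.length ∧ c.hol = b.hol) D' D₁ by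
    obtain ⟨D₁, h1, h2, h3⟩ := hs
    exact ⟨D₁, ⟨hD.equivariant, h1 ▸ hD.nodup, h1 ▸ hD.fixed, h2⟩, h3⟩
  have hc := hD.cycle
  have hE := hD.equivariant
  clear hD
  induction h with
  | nil => exact ⟨[], rfl, by simp, .nil⟩
  | @cons b c D' D hbc _ ih =>
    obtain ⟨D₁, h1, h2, h3⟩ := ih fun b hb => hc b (List.mem_cons_of_mem _ hb)
    simp only [CycleBlock.shape, Prod.mk.injEq] at hbc
    obtain ⟨g, hg⟩ := isConj_iff.1 (ConjClasses.mk_eq_mk_iff_isConj.1 hbc.2)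
    refine ⟨⟨rmul c.head g⁻¹, c.tail.map (rmul · g⁻¹), b.hol⟩ :: D₁, ?_, ?_, .cons ?_ h3⟩
    · simp [h1, CycleBlock.support, Function.comp_def]
    · intro d hd
      rcases List.mem_cons.1 hd with rfl | hd
      · have := PathTo.rmul hE (hc c List.mem_cons_self) g⁻¹
        simpa [CycleBlock.IsCycleOf, rmul_rmul, ← hg, mul_assoc] using this
      · exact h2 d hd
    · simp [hbc.1]

/-- Once cycles are matched with equal lengths and equal holonomies, any `k` carrying the listed
points of one decomposition to those of the other intertwines the two maps; equivariance extends
this to the whole fibres. -/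
theorem CycleDecomp.isConj [Infinite X] {v w : AltWreath H X} {D D' : List (CycleBlock X H)}
    (hD : CycleDecomp (wreathAct v) D) (hD' : CycleDecomp (wreathAct w) D')
    (h : shapes D = shapes D') : IsConj v w := by
  obtain ⟨D, hD, h₁⟩ := hD.exists_shapes_eq_map
  obtain ⟨D', hD', h₂⟩ := hD'.exists_shapes_eq_map
  rw [h₁, h₂, Multiset.coe_eq_coe] at h
  -- Equality of the multisets of shapes lets `D'` be reordered so that shapes agree position by
  -- position.
  obtain ⟨D₂, hf, hp⟩ : Relation.Comp (List.Forall₂ fun s b => CycleBlock.shape b = s) List.Perm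
      (D.map CycleBlock.shape) D' := by
    rw [List.forall₂_comp_perm_eq_perm_comp_forall₂]
    exact ⟨_, h, by simp [List.forall₂_map_left_iff, List.forall₂_same]⟩
  rw [List.forall₂_map_left_iff] at hf
  obtain ⟨D₃, hD₃, hf₃⟩ := (hD'.perm hp.symm).exists_hol_eq hf
  have hlen : (blocksPoints D).length = (blocksPoints D₃).length := by
    clear hD hD₃ hf h h₁
    induction hf₃ with
    | nil => rfl
    | cons hbc _ ih => simp_all [blocksPoints]
  obtain ⟨k, hk⟩ := exists_wreathAct_map_eq (blocksPoints D) (blocksPoints D₃)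
    (by rw [map_fst_blocksPoints]; exact hD.nodup)
    (by rw [map_fst_blocksPoints]; exact hD₃.nodup) hlen
  obtain rfl := map_eq_of_map_blocksPoints hf₃ hk
  refine isConj_iff.2 ⟨k, ?_⟩
  suffices hkv : k * v = w * k by rw [hkv, mul_inv_cancel_right]
  refine wreathAct_injective (funext fun z => ?_)
  rw [wreathAct_mul, wreathAct_mul, Function.comp_apply, Function.comp_apply]
  by_cases hz : z.1 ∈ blocksSupport D
  · obtain ⟨b, hb, hzb⟩ := mem_blocksSupport.1 hz
    have hc := hD₃.cycle _ (List.mem_map_of_mem hb)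
    rw [CycleBlock.IsCycleOf, CycleBlock.map, ← rightEquivariant_wreathAct k] at hc
    have hi := PathTo.intertwine (K := wreathAct k) (hD.cycle b hb) hc
    obtain ⟨y, hy, hyz⟩ : ∃ y ∈ b.head :: b.tail, y.1 = z.1 := by
      rw [CycleBlock.support, ← List.map_cons] at hzb
      exact List.mem_map.1 hzb
    rw [eq_rmul_of_fst_eq hyz.symm]
    simp only [rightEquivariant_wreathAct _ _ _, hi y hy]
  · rw [hD.fixed z hz, hD₃.fixed]
    rw [blocksSupport_map (σ := (k.right : Equiv.Perm X)) fun _ => rfl]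
    intro hm
    obtain ⟨x, hx, hxz⟩ := List.mem_map.1 hm
    exact hz ((Equiv.injective _ hxz) ▸ hx)

end ShapeInvariance

section CycleSurgery

variable {X H : Type*}

theorem PathTo.comp_left {E F : X × H → X × H} {z t : X × H} {l : List (X × H)}
    (h : PathTo F z l t) (hl : ∀ y ∈ l, E y = y) (ht : E t = t) : PathTo (E ∘ F) z l t := by
  induction l generalizing z with
  | nil => exact (congrArg E h).trans ht
  | cons x l ih =>
    exact ⟨(congrArg E h.1).trans (hl x List.mem_cons_self),
      ih h.2 fun y hy => hl y (List.mem_cons_of_mem _ hy)⟩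

variable [Group H]

/-! ### Assembling maps with prescribed cycles -/

theorem cycleDecomp_id : CycleDecomp (id : X × H → X × H) [] :=
  ⟨fun _ _ => rfl, by simp, fun _ _ => rfl, by simp⟩

theorem CycleDecomp.cons_fixed {E : X × H → X × H} {D : List (CycleBlock X H)}
    (hD : CycleDecomp E D) {x : X} (hx : x ∉ blocksSupport D) :
    CycleDecomp E (⟨(x, 1), [], 1⟩ :: D) := by
  refine ⟨hD.equivariant, List.nodup_cons.2 ⟨hx, hD.nodup⟩, fun z hz => hD.fixed z fun hz' => ?_,
    fun b hb => ?_⟩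
  · exact hz (by rw [blocksSupport_cons]; exact List.mem_append_right _ hz')
  · rcases List.mem_cons.1 hb with rfl | hb
    · simpa [CycleBlock.IsCycleOf, PathTo] using hD.fixed (x, 1) hx
    · exact hD.cycle b hb

theorem CycleDecomp.cons_start {E : X × H → X × H} {b : CycleBlock X H}
    {D : List (CycleBlock X H)} (hD : CycleDecomp E (b :: D)) {x : X} (hx : x ∈ b.support)
    (hb : b.hol = 1) : ∃ l, CycleDecomp E (⟨(x, 1), l, 1⟩ :: D) ∧
      l.length = b.tail.length ∧ (x :: l.map Prod.fst).Perm b.support := by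
  obtain ⟨l, h, hc, hs, hsh⟩ := (hD.cycle b List.mem_cons_self).exists_start hD.equivariant hx
  simp only [CycleBlock.shape, hb, Prod.mk.injEq] at hsh
  obtain rfl : h = 1 := by
    have := hsh.2
    rwa [ConjClasses.mk_eq_mk_iff_isConj, isConj_comm, isConj_one_right] at this
  exact ⟨l, hD.replace (B := [b]) (B' := [_]) hD.equivariant (fun _ _ => rfl) (by simpa using hs)
    (by simpa using hc), hsh.1, hs⟩

theorem CycleDecomp.exists_merge {E : X × H → X × H} {b c : CycleBlock X H}
    {D : List (CycleBlock X H)} (hD : CycleDecomp E (b :: c :: D)) (hb : b.hol = 1)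
    (hc : c.hol = 1) {x y : X} (hx : x ∈ b.support) (hy : y ∈ c.support) :
    ∃ d, CycleDecomp (E ∘ swapAct H x y) (d :: D) ∧ d.hol = 1 ∧
      d.tail.length = b.tail.length + c.tail.length + 1 ∧
      ∀ u, u ∈ d.support ↔ u ∈ b.support ∨ u ∈ c.support := by
  obtain ⟨l, hD, hl, hls⟩ := hD.cons_start hx hb
  obtain ⟨m, hD, hm, hms⟩ := (hD.perm (.swap _ _ _)).cons_start hy hc
  refine ⟨_, (hD.perm (.swap _ _ _)).merge (rightEquivariant_swapAct x y) (swapAct_left _ _ _)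
    (swapAct_right _ _ _) fun _ => swapAct_of_ne, mul_one 1, by simp; omega, fun u => ?_⟩
  rw [← hls.mem_iff, ← hms.mem_iff]
  simp only [CycleBlock.support, List.map_append, List.map_cons, List.map_map, rmul_fst,
    Function.comp_def, List.mem_cons, List.mem_append]
  tauto

/-- The 3-cycle is two swaps, each merging a fixed point into the cycle of `x`; all holonomies stay
trivial. -/
theorem CycleDecomp.exists_attach {E : X × H → X × H} {b : CycleBlock X H}
    {D : List (CycleBlock X H)} (hD : CycleDecomp E (b :: D)) (hb : b.hol = 1) {x y z : X}
    (hx : x ∈ b.support) (hy : y ∉ blocksSupport (b :: D)) (hz : z ∉ blocksSupport (b :: D))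
    (hyz : y ≠ z) :
    ∃ d, CycleDecomp (E ∘ (swapAct H x y ∘ swapAct H y z)) (d :: D) ∧ d.hol = 1 ∧
      d.tail.length = b.tail.length + 2 ∧ ∀ u, u ∈ d.support ↔ u ∈ b.support ∨ u = y ∨ u = z := by
  have h₁ := (hD.cons_fixed hz).cons_fixed (x := y) (by
    rw [blocksSupport_cons]
    simpa [CycleBlock.support, hyz] using hy)
  have hp : (⟨(y, 1), [], 1⟩ :: ⟨(z, 1), [], 1⟩ :: b :: D : List (CycleBlock X H)).Perm
      (b :: ⟨(y, 1), [], 1⟩ :: ⟨(z, 1), [], 1⟩ :: D) :=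
    ((List.Perm.swap _ _ _).cons _).trans (List.Perm.swap _ _ _)
  obtain ⟨c, hc, hc1, hcl, hcs⟩ := (h₁.perm hp).exists_merge hb rfl hx (y := y)
    (by simp [CycleBlock.support])
  obtain ⟨d, hd, hd1, hdl, hds⟩ := hc.exists_merge hc1 rfl (x := y) (y := z)
    ((hcs y).2 (.inr (by simp [CycleBlock.support]))) (by simp [CycleBlock.support])
  refine ⟨d, hd, hd1, by simp [hdl, hcl], fun u => ?_⟩
  rw [hds, hcs]
  simp [CycleBlock.support, or_assoc]

theorem CycleDecomp.comp {E F : X × H → X × H} {D D' : List (CycleBlock X H)}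
    (hD : CycleDecomp E D) (hD' : CycleDecomp F D')
    (hdisj : (blocksSupport D).Disjoint (blocksSupport D')) : CycleDecomp (E ∘ F) (D ++ D') := by
  refine ⟨hD.equivariant.comp hD'.equivariant, ?_, fun z hz => ?_, fun b hb => ?_⟩
  · rw [blocksSupport_append]
    exact hD.nodup.append hD'.nodup hdisj
  · simp only [blocksSupport_append, List.mem_append, not_or] at hz
    simp [hD'.fixed z hz.2, hD.fixed z hz.1]
  · rcases List.mem_append.1 hb with hb | hb
    · refine PathTo.congr (hD.cycle b hb) fun y hy => ?_
      rw [Function.comp_apply, hD'.fixed y]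
      exact hdisj (mem_blocksSupport.2 ⟨b, hb, CycleBlock.fst_mem_support hy⟩)
    · have hfix : ∀ y : X × H, y.1 ∈ b.support → E y = y := fun y hy =>
        hD.fixed y fun hy' => hdisj hy' (mem_blocksSupport.2 ⟨b, hb, hy⟩)
      exact (hD'.cycle b hb).comp_left
        (fun y hy => hfix y (CycleBlock.fst_mem_support (List.mem_cons_of_mem _ hy)))
        (hfix _ (CycleBlock.fst_mem_support (y := b.head) List.mem_cons_self))

end CycleSurgery

/-! ### Realising prescribed shapes by short words -/

section Construction

variable {X H : Type*} [Group H]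

/-- The element `w` is a product of at most `n` elements of `S ∪ S⁻¹`. -/
def WordLe {G : Type*} [Group G] (S : Set G) (n : ℕ) (w : G) : Prop :=
  ∃ l, IsWord S l ∧ l.length ≤ n ∧ l.prod = w

theorem wordLe_one {G : Type*} [Group G] (S : Set G) (n : ℕ) : WordLe S n 1 :=
  ⟨[], by simp [IsWord], by simp, rfl⟩

theorem wordLe_of_mem {G : Type*} [Group G] {S : Set G} {s : G} (hs : s ∈ S ∨ s⁻¹ ∈ S) :
    WordLe S 1 s := ⟨[s], by simpa [IsWord] using hs, by simp, by simp⟩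

theorem WordLe.mul {G : Type*} [Group G] {S : Set G} {m n : ℕ} {v w : G} (hv : WordLe S m v)
    (hw : WordLe S n w) : WordLe S (m + n) (v * w) := by
  obtain ⟨l, hl, hlm, rfl⟩ := hv
  obtain ⟨l', hl', hln, rfl⟩ := hw
  refine ⟨l ++ l', fun s hs => ?_, by simp; omega, by simp⟩
  rcases List.mem_append.1 hs with hs | hs
  · exact hl s hs
  · exact hl' s hs

theorem WordLe.mono {G : Type*} [Group G] {S : Set G} {m n : ℕ} {w : G} (hw : WordLe S m w)
    (h : m ≤ n) : WordLe S n w := by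
  obtain ⟨l, hl, hlm, rfl⟩ := hw
  exact ⟨l, hl, hlm.trans h, rfl⟩

theorem IsThreeCyc.rotate {w : AltWreath H X} {x y z : X} (h : IsThreeCyc w x y z) :
    IsThreeCyc w y z x := by
  classical
  obtain ⟨hxy, hyz, hxz, hl, hr⟩ := h
  refine ⟨hyz, hxz.symm, hxy.symm, hl, ?_⟩
  rw [hr]
  ext u
  simp only [Equiv.Perm.mul_apply, Equiv.swap_apply_def]
  split_ifs <;> simp_all

theorem IsTriple.exists_isThreeCyc {S : Set (AltWreath H X)} {x y z : X} (h : IsTriple S x y z) :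
    ∃ w, WordLe S 1 w ∧ IsThreeCyc w x y z := by
  obtain ⟨w, hw, h | h⟩ := h
  · exact ⟨w, wordLe_of_mem (.inl hw), h⟩
  · exact ⟨w⁻¹, wordLe_of_mem (.inr (by simpa using hw)), h.inv.rotate.rotate⟩

theorem IsTripleTree.exists_cycle {S : Set (AltWreath H X)} {a : ℕ} {V : Set X}
    (h : IsTripleTree S a V) : ∃ w b, WordLe S a w ∧ CycleDecomp (wreathAct w) [b] ∧ b.hol = 1 ∧
      b.tail.length = 2 * a ∧ ∀ u, u ∈ b.support ↔ u ∈ V := by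
  induction h with
  | vertex x =>
    refine ⟨1, ⟨(x, 1), [], 1⟩, wordLe_one _ _, ?_, rfl, rfl,
      fun u => by simp [CycleBlock.support]⟩
    rw [wreathAct_one]
    exact cycleDecomp_id.cons_fixed (by simp)
  | @attach a V x y z _ hx hy hz ht ih =>
    obtain ⟨w, b, hw, hD, hb, hl, hs⟩ := ih
    obtain ⟨v, hv, hc⟩ := ht.exists_isThreeCyc
    obtain ⟨d, hd, hd1, hdl, hds⟩ := hD.exists_attach hb ((hs x).2 hx) (y := y) (z := z)
      (by simpa [hs] using hy) (by simpa [hs] using hz) hc.2.1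
    refine ⟨w * v, d, hw.mul hv, ?_, hd1, by omega, fun u => ?_⟩
    · rwa [wreathAct_mul, hc.wreathAct]
    · rw [hds, hs]
      rfl

theorem IsEvenPair.exists_cycles {S : Set (AltWreath H X)} {b c : ℕ} {P Q : Set X}
    (h : IsEvenPair S b c P Q) : ∃ w p q, WordLe S (b + c) w ∧ CycleDecomp (wreathAct w) [p, q] ∧
      p.hol = 1 ∧ q.hol = 1 ∧ p.tail.length + 1 = 2 * b ∧ q.tail.length + 1 = 2 * c ∧
      (∀ u, u ∈ p.support ↔ u ∈ P) ∧ ∀ u, u ∈ q.support ↔ u ∈ Q := by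
  induction h with
  | @base x y z w hxw h₁ h₂ =>
    obtain ⟨v₁, hv₁, hc₁⟩ := h₁.exists_isThreeCyc
    obtain ⟨v₂, hv₂, hc₂⟩ := h₂.exists_isThreeCyc
    -- The inner swaps of `y` and `z` cancel, leaving two disjoint transpositions.
    have hact : wreathAct (v₁ * v₂) = id ∘ swapAct H x y ∘ swapAct H z w := by
      rw [wreathAct_mul, hc₁.wreathAct, hc₂.wreathAct]
      ext u <;> simp [swapAct]
    obtain ⟨hxy, hyz, hxz, -⟩ := hc₁
    obtain ⟨-, hzw, hyw, -⟩ := hc₂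
    have hD := (((cycleDecomp_id (X := X) (H := H)).cons_fixed (x := w) (by simp)).cons_fixed
      (x := z) (by simpa [CycleBlock.support] using hzw)).cons_fixed (x := y)
      (by simpa [CycleBlock.support] using ⟨hyz, hyw⟩) |>.cons_fixed (x := x)
      (by simpa [CycleBlock.support] using ⟨hxy, hxz, hxw⟩)
    obtain ⟨p, hp, hp1, hpl, hps⟩ := hD.exists_merge rfl rfl (x := x) (y := y)
      (by simp [CycleBlock.support]) (by simp [CycleBlock.support])
    have hp' := hp.perm (List.perm_append_comm (l₁ := [p]))
    obtain ⟨q, hq, hq1, hql, hqs⟩ := hp'.exists_merge rfl rfl (x := z) (y := w)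
      (by simp [CycleBlock.support]) (by simp [CycleBlock.support])
    refine ⟨v₁ * v₂, p, q, hv₁.mul hv₂, ?_, hp1, hq1, by simp [hpl], by simp [hql], fun u => ?_,
      fun u => ?_⟩
    · rw [hact]
      exact hq.perm (.swap _ _ _)
    · rw [hps]
      simp [CycleBlock.support]
    · rw [hqs]
      simp [CycleBlock.support]
  | @attachLeft b c P Q x y z _ hx hy hz ht ih =>
    obtain ⟨w, p, q, hw, hD, hp, hq, hpl, hql, hps, hqs⟩ := ih
    obtain ⟨v, hv, hc⟩ := ht.exists_isThreeCyc
    obtain ⟨d, hd, hd1, hdl, hds⟩ := hD.exists_attach hp ((hps x).2 hx) (y := y) (z := z)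
      (by simpa [hps, hqs] using hy) (by simpa [hps, hqs] using hz) hc.2.1
    refine ⟨w * v, d, q, (hw.mul hv).mono (by omega), ?_, hd1, hq, by omega, hql, fun u => ?_, hqs⟩
    · rwa [wreathAct_mul, hc.wreathAct]
    · rw [hds, hps]
      rfl
  | @attachRight b c P Q x y z _ hx hy hz ht ih =>
    obtain ⟨w, p, q, hw, hD, hp, hq, hpl, hql, hps, hqs⟩ := ih
    obtain ⟨v, hv, hc⟩ := ht.exists_isThreeCyc
    obtain ⟨d, hd, hd1, hdl, hds⟩ := (hD.perm (.swap _ _ _)).exists_attach hq ((hqs x).2 hx)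
      (y := y) (z := z) (by simpa [hps, hqs, or_comm] using hy)
      (by simpa [hps, hqs, or_comm] using hz) hc.2.1
    refine ⟨w * v, p, d, (hw.mul hv).mono (by omega), ?_, hp, hd1, hpl, by omega, hps, fun u => ?_⟩
    · rw [wreathAct_mul, hc.wreathAct]
      exact hd.perm (.swap _ _ _)
    · rw [hds, hqs]
      rfl

/-- A letter at a full point multiplies the trivial holonomy by `a`, so one letter reaches any
class; the trivial class needs none. -/
theorem IsFull.exists_shape {S : Set (AltWreath H X)} {u : X} (hu : IsFull S u)
    {w : AltWreath H X} {b : CycleBlock X H} {D : List (CycleBlock X H)}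
    (hD : CycleDecomp (wreathAct w) (b :: D)) (hb : b.hol = 1) (hub : u ∈ b.support)
    (κ : ConjClasses H) :
    ∃ v d, WordLe S 1 v ∧ CycleDecomp (wreathAct (w * v)) (d :: D) ∧
      d.shape = (b.tail.length, κ) ∧ ∀ x, x ∈ d.support ↔ x ∈ b.support := by
  obtain ⟨a, rfl⟩ := ConjClasses.mk_surjective κ
  by_cases ha : a = 1
  · exact ⟨1, b, wordLe_one _ _, by simpa using hD, by simp [CycleBlock.shape, hb, ha], by simp⟩
  · obtain ⟨v, hv, hp⟩ := hu a ha
    obtain ⟨l, hD, hl, hls⟩ := hD.cons_start hub hb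
    refine ⟨v, ⟨(u, a⁻¹), l, a * 1⟩, wordLe_of_mem (.inl hv), ?_, ?_, ?_⟩
    · rw [wreathAct_mul]
      exact hD.comp_point (rightEquivariant_wreathAct v) (by simp [hp.wreathAct_self])
        fun z hz => hp.wreathAct_of_ne hz
    · simp [CycleBlock.shape, hl]
    · exact fun x => hls.mem_iff

/-- Some product of at most `n` elements of `S ∪ S⁻¹` is supported on `U` and has cycles of the
shapes `s`. -/
def Realizes (S : Set (AltWreath H X)) (n : ℕ) (U : Set X) (s : Multiset (ℕ × ConjClasses H)) :
    Prop :=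
  ∃ w D, WordLe S n w ∧ CycleDecomp (wreathAct w) D ∧ (∀ u ∈ blocksSupport D, u ∈ U) ∧
    (D.map CycleBlock.shape : List (ℕ × ConjClasses H)) = s

theorem IsTripleTree.realizes {S : Set (AltWreath H X)} {a : ℕ} {V : Set X}
    (h : IsTripleTree S a V) (hV : ∃ u ∈ V, IsFull S u) (κ : ConjClasses H) :
    Realizes S (a + 1) V {(2 * a, κ)} := by
  obtain ⟨w, b, hw, hD, hb, hl, hs⟩ := h.exists_cycle
  obtain ⟨u, huV, hu⟩ := hV
  obtain ⟨v, d, hv, hd, hsh, hds⟩ := hu.exists_shape hD hb ((hs u).2 huV) κ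
  exact ⟨_, _, hw.mul hv, hd, by simp [hds, hs], by simp [hsh, hl]⟩

theorem IsEvenPair.realizes {S : Set (AltWreath H X)} {b c : ℕ} {P Q : Set X}
    (h : IsEvenPair S (b + 1) (c + 1) P Q) (hP : ∃ u ∈ P, IsFull S u) (hQ : ∃ u ∈ Q, IsFull S u)
    (κ μ : ConjClasses H) :
    Realizes S ((b + 2) + (c + 2)) (P ∪ Q) {(2 * b + 1, κ), (2 * c + 1, μ)} := by
  obtain ⟨w, p, q, hw, hD, hp, hq, hpl, hql, hps, hqs⟩ := h.exists_cycles
  obtain ⟨u, huP, hu⟩ := hP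
  obtain ⟨y, hyQ, hy⟩ := hQ
  obtain ⟨v, p', hv, hD, hsh, hps'⟩ := hu.exists_shape hD hp ((hps u).2 huP) κ
  obtain ⟨v', q', hv', hD, hsh', hqs'⟩ := hy.exists_shape (hD.perm (.swap _ _ _)) hq
    ((hqs y).2 hyQ) μ
  refine ⟨_, _, ((hw.mul hv).mul hv').mono (by omega), hD.perm (.swap _ _ _), ?_, ?_⟩
  · simp only [blocksSupport_cons, blocksSupport_nil, List.mem_append, hqs', hqs, hps', hps]
    simp
  · rw [List.map_cons, List.map_cons, hsh, hsh', show p.tail.length = 2 * b + 1 by omega,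
      show q.tail.length = 2 * c + 1 by omega]
    rfl

theorem realizes_sum {S : Set (AltWreath H X)} {ι : Type*} (t : Finset ι) {n : ι → ℕ}
    {U : ι → Set X} {s : ι → Multiset (ℕ × ConjClasses H)} (hU : Pairwise fun i j =>
      Disjoint (U i) (U j)) (h : ∀ i, Realizes S (n i) (U i) (s i)) :
    Realizes S (∑ i ∈ t, n i) (⋃ i ∈ t, U i) (∑ i ∈ t, s i) := by
  classical
  induction t using Finset.induction_on with
  | empty =>
    refine ⟨1, [], wordLe_one _ _, ?_, by simp, rfl⟩
    rw [wreathAct_one]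
    exact cycleDecomp_id
  | insert i t hi ih =>
    obtain ⟨v, D, hv, hD, hDU, hDs⟩ := h i
    obtain ⟨w, D', hw, hD', hDU', hDs'⟩ := ih
    rw [Finset.sum_insert hi, Finset.sum_insert hi]
    refine ⟨v * w, D ++ D', hv.mul hw, ?_, fun u hu => ?_, ?_⟩
    · rw [wreathAct_mul]
      refine hD.comp hD' fun u hu hu' => ?_
      obtain ⟨j, hj, huj⟩ := Set.mem_iUnion₂.1 (hDU' u hu')
      exact Set.disjoint_left.1 (hU (show i ≠ j by rintro rfl; exact hi hj)) (hDU u hu) huj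
    · rw [Finset.set_biUnion_insert]
      rw [blocksSupport_append] at hu
      exact (List.mem_append.1 hu).imp (hDU u) (hDU' u)
    · rw [List.map_append, ← Multiset.coe_add, hDs, hDs']

theorem IsSufficientlyLarge.realizes {S : Set (AltWreath H X)} (hS : IsSufficientlyLarge S)
    (A : List (ConjClasses H × ℕ)) (B : List ((ConjClasses H × ℕ) × (ConjClasses H × ℕ))) :
    Realizes S ((A.map fun p => p.2 + 1).sum + (B.map fun p => (p.1.2 + 2) + (p.2.2 + 2)).sum)
      Set.univ ((A.map fun p => ({(2 * p.2, p.1)} : Multiset (ℕ × ConjClasses H))).sum +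
        (B.map fun p => ({(2 * p.1.2 + 1, p.1.1), (2 * p.2.2 + 1, p.2.1)} :
          Multiset (ℕ × ConjClasses H))).sum) := by
  obtain ⟨V, P, Q, hV, hPQ, hdisj⟩ := hS.complete A.length B.length (fun i => A[i].2)
    (fun j => B[j].1.2 + 1) (fun j => B[j].2.2 + 1) (by simp) (by simp)
  have h := realizes_sum (S := S) Finset.univ
    (n := Sum.elim (fun i : Fin A.length => A[i].2 + 1)
      (fun j : Fin B.length => (B[j].1.2 + 2) + (B[j].2.2 + 2)))
    (s := Sum.elim (fun i : Fin A.length => {(2 * A[i].2, A[i].1)})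
      (fun j : Fin B.length => {(2 * B[j].1.2 + 1, B[j].1.1), (2 * B[j].2.2 + 1, B[j].2.1)}))
    hdisj (by
      rintro (i | j)
      · exact (hV i).1.realizes (hV i).2 _
      · exact (hPQ j).1.realizes (hPQ j).2.1 (hPQ j).2.2 _ _)
  simp only [Fintype.sum_sum_type, Sum.elim_inl, Sum.elim_inr] at h
  obtain ⟨w, D, hw, hD, -, hs⟩ := h
  refine ⟨w, D, ?_, hD, by simp, ?_⟩
  · simpa only [← Fin.sum_univ_fun_getElem, Fin.getElem_fin] using hw
  · simpa only [← Fin.sum_univ_fun_getElem, Fin.getElem_fin] using hs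

/-! ### Encoding coloured partitions by conjugacy classes -/

theorem exists_pairs_of_even {α : Type*} (L : List α) (hL : Even L.length) :
    ∃ B : List (α × α), B.flatMap (fun p => [p.1, p.2]) = L := by
  induction L using List.twoStepInduction with
  | nil => exact ⟨[], rfl⟩
  | singleton x => simp at hL
  | cons_cons x y L ih _ =>
    obtain ⟨B, hB⟩ := ih (by simpa [Nat.even_add_one] using hL)
    exact ⟨(x, y) :: B, by simp [hB]⟩

/-- The shape that encodes a part `j` of the partition with the given label: odd cycles for the
label `false`, even cycles for the label `true`. -/
def partShape (p : (ConjClasses H × Bool) × ℕ) : ℕ × ConjClasses H :=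
  (2 * p.2 + 2 + p.1.2.toNat, p.1.1)

theorem partShape_injective : Function.Injective (partShape (H := H)) := by
  rintro ⟨⟨κ, i⟩, j⟩ ⟨⟨κ', i'⟩, j'⟩ h
  simp only [partShape, Prod.mk.injEq] at h ⊢
  cases i <;> cases i' <;> simp at h ⊢ <;> grind

/-- `A` collects the trees and `L` the halves of even pairs. With size parameter `j + 1`, a part `j`
costs `j + 2` or `j + 3` letters, both at most `j + 3`. -/
theorem exists_lists_of_parts (f : Multiset ((ConjClasses H × Bool) × ℕ)) :
    ∃ A L : List (ConjClasses H × ℕ),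
      (A.map fun p => ({(2 * p.2, p.1)} : Multiset (ℕ × ConjClasses H))).sum +
        (L.map fun p => ({(2 * p.2 + 1, p.1)} : Multiset (ℕ × ConjClasses H))).sum =
          f.map partShape ∧
      (A.map fun p => p.2 + 1).sum + (L.map fun p => p.2 + 2).sum ≤
        (f.map fun p => p.2 + 3).sum := by
  induction f using Multiset.induction_on with
  | empty => exact ⟨[], [], by simp, by simp⟩
  | cons p f ih =>
    obtain ⟨A, L, hs, hc⟩ := ih
    obtain ⟨⟨κ, i⟩, j⟩ := p
    cases i
    · refine ⟨(κ, j + 1) :: A, L, ?_, ?_⟩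
      · rw [Multiset.map_cons, ← hs, ← Multiset.singleton_add, List.map_cons, List.sum_cons,
          add_assoc]
        rfl
      · simp only [List.map_cons, List.sum_cons, Multiset.map_cons, Multiset.sum_cons]
        omega
    · refine ⟨A, (κ, j + 1) :: L, ?_, ?_⟩
      · rw [Multiset.map_cons, ← hs, ← Multiset.singleton_add, List.map_cons, List.sum_cons,
          add_left_comm]
        rfl
      · simp only [List.map_cons, List.sum_cons, Multiset.map_cons, Multiset.sum_cons]
        omega

theorem IsSufficientlyLarge.exists_of_parts {S : Set (AltWreath H X)} (hS : IsSufficientlyLarge S)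
    (f : Multiset ((ConjClasses H × Bool) × ℕ)) :
    ∃ w D, WordLe S ((f.map fun p => p.2 + 3).sum + 2) w ∧ CycleDecomp (wreathAct w) D ∧
      (shapes D).filter (fun s => s.1 ≠ 1) = f.map partShape := by
  obtain ⟨A, L, hs, hc⟩ := exists_lists_of_parts f
  obtain ⟨L', hL', hs', hc'⟩ : ∃ L' : List (ConjClasses H × ℕ), Even L'.length ∧
      ((L'.map fun p => ({(2 * p.2 + 1, p.1)} : Multiset (ℕ × ConjClasses H))).sum).filter
        (fun s => s.1 ≠ 1) =
      ((L.map fun p => ({(2 * p.2 + 1, p.1)} : Multiset (ℕ × ConjClasses H))).sum).filter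
        (fun s => s.1 ≠ 1) ∧
      (L'.map fun p => p.2 + 2).sum ≤ (L.map fun p => p.2 + 2).sum + 2 := by
    rcases Nat.even_or_odd L.length with he | ho
    · exact ⟨L, he, rfl, by omega⟩
    -- An odd number of even cycles is completed by a cycle of two points. No part is encoded by a
    -- cycle of that length, so the filter `s.1 ≠ 1` removes it; it costs the extra `2` letters.
    · refine ⟨(ConjClasses.mk 1, 0) :: L, by simpa [Nat.even_add_one] using ho, ?_, by simp; omega⟩
      simp
  obtain ⟨B, rfl⟩ := exists_pairs_of_even L' hL'
  obtain ⟨w, D, hw, hD, -, hDs⟩ := hS.realizes A B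
  have hB₁ : (B.map fun p => (p.1.2 + 2) + (p.2.2 + 2)).sum =
      ((B.flatMap fun p => [p.1, p.2]).map fun p => p.2 + 2).sum := by
    clear * -
    induction B with
    | nil => rfl
    | cons p B ih => simp [ih]; ring
  have hB₂ : (B.map fun p => ({(2 * p.1.2 + 1, p.1.1), (2 * p.2.2 + 1, p.2.1)} :
        Multiset (ℕ × ConjClasses H))).sum =
      ((B.flatMap fun p => [p.1, p.2]).map fun p =>
        ({(2 * p.2 + 1, p.1)} : Multiset (ℕ × ConjClasses H))).sum := by
    clear * -
    induction B with
    | nil => rfl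
    | cons p B ih =>
      simp only [List.map_cons, List.sum_cons, ih, List.flatMap_cons, List.map_append,
        List.sum_append]
      rfl
  refine ⟨w, D, hw.mono (by omega), hD, ?_⟩
  have hne : ∀ s ∈ f.map (partShape (H := H)), s ≠ trivialShape H ∧ s.1 ≠ 1 := by
    intro s hs
    obtain ⟨p, -, rfl⟩ := Multiset.mem_map.1 hs
    constructor
    · intro h
      have := congrArg Prod.fst h
      simp [partShape, trivialShape] at this
    · simp only [partShape]
      omega
  have hA : ((A.map fun p => ({(2 * p.2, p.1)} : Multiset (ℕ × ConjClasses H))).sum +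
      ((B.flatMap fun p => [p.1, p.2]).map fun p =>
        ({(2 * p.2 + 1, p.1)} : Multiset (ℕ × ConjClasses H))).sum).filter (fun s => s.1 ≠ 1) =
      f.map partShape := by
    rw [Multiset.filter_add, hs', ← Multiset.filter_add, hs]
    exact Multiset.filter_eq_self.2 fun s hs => (hne s hs).2
  rw [hB₂] at hDs
  classical
  rw [shapes, hDs, Multiset.filter_comm, hA]
  exact Multiset.filter_eq_self.2 fun s hs => (hne s hs).1

end Construction

section Asymptotics

open Filter Topology

/-! ### Counting coloured partitions -/

-- Finite Euler product: expanding it gives one term for each multiset on `P` with all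
-- multiplicities below `K`.
open scoped Classical in
theorem exists_finset_multiset {α : Type*} (P : Finset α) {K : ℕ} (hK : 0 < K) (q : α → ℝ) :
    ∃ G : Finset (Multiset α), (∀ f, f ∈ G ↔ (∀ p ∈ f, p ∈ P) ∧ ∀ p, f.count p < K) ∧
      ∑ f ∈ G, (f.map q).prod = ∏ p ∈ P, ∑ k ∈ Finset.range K, q p ^ k := by
  induction P using Finset.induction_on with
  | empty =>
    refine ⟨{0}, fun f => ?_, by simp⟩
    constructor
    · intro h
      simp [Finset.mem_singleton.1 h, hK]
    · rintro ⟨h, -⟩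
      exact Finset.mem_singleton.2 (Multiset.eq_zero_of_forall_notMem fun p hp => by
        simpa using h p hp)
  | insert a P ha ih =>
    obtain ⟨G, hG, hs⟩ := ih
    have hcount : ∀ f ∈ G, f.count a = 0 := fun f hf =>
      Multiset.count_eq_zero.2 fun h => ha (((hG f).1 hf).1 a h)
    refine ⟨(Finset.range K ×ˢ G).image fun x => Multiset.replicate x.1 a + x.2, fun f => ?_, ?_⟩
    · simp only [Finset.mem_image, Finset.mem_product, Finset.mem_range, Prod.exists]
      constructor
      · rintro ⟨k, g, ⟨hk, hg⟩, rfl⟩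
        refine ⟨fun p hp => ?_, fun p => ?_⟩
        · rcases Multiset.mem_add.1 hp with hp | hp
          · simp [Multiset.eq_of_mem_replicate hp]
          · exact Finset.mem_insert_of_mem (((hG g).1 hg).1 p hp)
        · by_cases hpa : p = a
          · subst hpa
            simpa [hcount g hg] using hk
          · simpa [Multiset.count_replicate, Ne.symm hpa] using ((hG g).1 hg).2 p
      · rintro ⟨h₁, h₂⟩
        refine ⟨f.count a, f.filter (· ≠ a), ⟨h₂ a, (hG _).2 ⟨fun p hp => ?_, fun p => ?_⟩⟩, ?_⟩
        · obtain ⟨hp, hpa⟩ := Multiset.mem_filter.1 hp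
          exact Finset.mem_of_mem_insert_of_ne (h₁ p hp) hpa
        · exact (Multiset.count_le_of_le p (Multiset.filter_le _ _)).trans_lt (h₂ p)
        · rw [← Multiset.filter_eq' f a]
          exact Multiset.filter_add_not _ _
    · rw [Finset.sum_image, Finset.sum_product, Finset.prod_insert ha, ← hs, Finset.sum_mul_sum]
      · simp
      · rintro ⟨k, f⟩ hf ⟨l, g⟩ hg h
        simp only [Finset.coe_product, Set.mem_prod, Finset.mem_coe] at hf hg
        have hkl : k = l := by
          simpa [hcount f hf.2, hcount g hg.2] using congrArg (Multiset.count a) h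
        subst hkl
        simpa using h

theorem prod_map_exp {α : Type*} (f : Multiset α) (w : α → ℕ) (t : ℝ) :
    (f.map fun p => Real.exp (-(t * w p))).prod = Real.exp (-(t * (f.map w).sum)) := by
  induction f using Multiset.induction_on with
  | empty => simp
  | cons p f ih =>
    rw [Multiset.map_cons, Multiset.prod_cons, ih, ← Real.exp_add, Multiset.map_cons,
      Multiset.sum_cons]
    push_cast
    ring_nf

theorem geom_sum_le_inv {x : ℝ} (h0 : 0 ≤ x) (h1 : x < 1) (K : ℕ) :
    ∑ k ∈ Finset.range K, x ^ k ≤ (1 - x)⁻¹ := by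
  rw [← tsum_geometric_of_lt_one h0 h1]
  exact (summable_geometric_of_lt_one h0 h1).sum_le_tsum _ fun i _ => pow_nonneg h0 i

theorem exp_neg_lt_one {x : ℝ} (hx : 0 < x) : Real.exp (-x) < 1 := by
  simpa using hx

/-- Expand each logarithm and sum over `j` first: the geometric sum is at most `1 / (exp (t (m + 1))
- 1) ≤ 1 / (t (m + 1))`. What remains is `ζ(2) / t`. -/
theorem sum_neg_log_le {t : ℝ} (ht : 0 < t) (J : ℕ) :
    ∑ j ∈ Finset.range J, -Real.log (1 - Real.exp (-(t * ((j + 1 : ℕ) : ℝ)))) ≤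
      Real.pi ^ 2 / (6 * t) := by
  have h1 : HasSum (fun m : ℕ => ∑ j ∈ Finset.range J,
      Real.exp (-(t * ((j + 1 : ℕ) : ℝ))) ^ (m + 1) / ((m : ℝ) + 1))
      (∑ j ∈ Finset.range J, -Real.log (1 - Real.exp (-(t * ((j + 1 : ℕ) : ℝ))))) := by
    refine hasSum_sum fun j _ => Real.hasSum_pow_div_log_of_abs_lt_one ?_
    rw [abs_of_pos (Real.exp_pos _)]
    exact exp_neg_lt_one (by positivity)
  have h2 : HasSum (fun m : ℕ => 1 / t * (1 / ((m + 1 : ℕ) : ℝ) ^ 2))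
      (1 / t * (Real.pi ^ 2 / 6)) := by
    have := (hasSum_nat_add_iff' 1).2 hasSum_zeta_two
    simpa using this.mul_left (1 / t)
  refine (hasSum_le (fun m => ?_) h1 h2).trans (le_of_eq (by field_simp))
  have hs : 0 < t * ((m : ℝ) + 1) := by positivity
  have hy : Real.exp (-(t * ((m : ℝ) + 1))) < 1 := exp_neg_lt_one hs
  have hgeom : ∑ j ∈ Finset.range J, Real.exp (-(t * ((j + 1 : ℕ) : ℝ))) ^ (m + 1) ≤
      1 / (t * ((m : ℝ) + 1)) := by
    have : ∀ j ∈ Finset.range J, Real.exp (-(t * ((j + 1 : ℕ) : ℝ))) ^ (m + 1) =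
        Real.exp (-(t * ((m : ℝ) + 1))) * Real.exp (-(t * ((m : ℝ) + 1))) ^ j := fun j _ => by
      rw [← pow_succ', ← Real.exp_nat_mul, ← Real.exp_nat_mul]
      push_cast
      ring_nf
    rw [Finset.sum_congr rfl this, ← Finset.mul_sum]
    refine (mul_le_mul_of_nonneg_left (geom_sum_le_inv (Real.exp_pos _).le hy J)
      (Real.exp_pos _).le).trans ?_
    rw [← div_eq_mul_inv, div_le_div_iff₀ (by linarith) hs, Real.exp_neg]
    have he := Real.add_one_le_exp (t * ((m : ℝ) + 1))
    have hep := Real.exp_pos (t * ((m : ℝ) + 1))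
    field_simp
    linarith
  rw [← Finset.sum_div, div_le_iff₀ (by positivity)]
  refine hgeom.trans (le_of_eq ?_)
  push_cast
  field_simp

/-- Each partition counted has weight at least `exp (-(t n))` in the generating function, which the
Euler product bounds. -/
theorem card_partitions_le {ι : Type*} [Fintype ι] (F : Finset (Multiset (ι × ℕ))) (n : ℕ)
    (hF : ∀ f ∈ F, (f.map fun p => p.2 + 1).sum ≤ n) {t : ℝ} (ht : 0 < t) :
    (F.card : ℝ) ≤ Real.exp (t * n + Fintype.card ι * (Real.pi ^ 2 / (6 * t))) := by
  classical
  set q : ι × ℕ → ℝ := fun p => Real.exp (-(t * ((p.2 + 1 : ℕ) : ℝ))) with hq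
  have hq1 : ∀ p, q p < 1 := fun p => exp_neg_lt_one (by positivity)
  -- The cutoff exceeds every multiplicity that occurs in `F`, so that `F ⊆ G`.
  obtain ⟨G, hG, hs⟩ := exists_finset_multiset (Finset.univ ×ˢ Finset.range n : Finset (ι × ℕ))
    (Nat.succ_pos (∑ f ∈ F, f.card)) q
  have hFG : F ⊆ G := fun f hf => by
    refine (hG f).2 ⟨fun p hp => ?_, fun p => ?_⟩
    · have := Multiset.single_le_sum (fun _ _ => Nat.zero_le _) _
        (Multiset.mem_map_of_mem (fun p : ι × ℕ => p.2 + 1) hp)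
      have := hF f hf
      simp only [Finset.mem_product, Finset.mem_univ, Finset.mem_range, true_and]
      omega
    · refine Nat.lt_succ_of_le ((@Multiset.count_le_card _ (fun _ _ => _) p f).trans ?_)
      exact Finset.single_le_sum (f := fun f : Multiset (ι × ℕ) => f.card)
        (fun _ _ => Nat.zero_le _) hf
  have h1 : F.card * Real.exp (-(t * n)) ≤ ∑ f ∈ F, (f.map q).prod := by
    rw [← nsmul_eq_mul]
    refine Finset.card_nsmul_le_sum _ _ _ fun f hf => ?_
    rw [hq, prod_map_exp f (fun p => p.2 + 1) t]
    refine Real.exp_le_exp.2 (neg_le_neg (mul_le_mul_of_nonneg_left ?_ ht.le))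
    exact_mod_cast hF f hf
  have h2 : ∑ f ∈ F, (f.map q).prod ≤ ∏ p ∈ Finset.univ ×ˢ Finset.range n, (1 - q p)⁻¹ := by
    refine (Finset.sum_le_sum_of_subset_of_nonneg hFG fun f _ _ =>
      Multiset.prod_nonneg fun x hx => ?_).trans ?_
    · obtain ⟨p, -, rfl⟩ := Multiset.mem_map.1 hx
      exact (Real.exp_pos _).le
    · rw [hs]
      exact Finset.prod_le_prod (fun p _ => Finset.sum_nonneg fun k _ =>
        pow_nonneg (Real.exp_pos _).le k) fun p _ =>
        geom_sum_le_inv (Real.exp_pos _).le (hq1 p) _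
  have h3 : ∏ p ∈ (Finset.univ ×ˢ Finset.range n : Finset (ι × ℕ)), (1 - q p)⁻¹ ≤
      Real.exp (Fintype.card ι * (Real.pi ^ 2 / (6 * t))) := by
    rw [Finset.prod_product_right]
    simp only [hq, Finset.prod_const, Finset.card_univ]
    rw [Finset.prod_pow, Real.exp_nat_mul]
    refine pow_le_pow_left₀ (Finset.prod_nonneg fun j _ => ?_) ?_ _
    · exact inv_nonneg.2 (by linarith [exp_neg_lt_one (x := t * ((j + 1 : ℕ) : ℝ)) (by positivity)])
    · refine le_trans (le_of_eq ?_) (Real.exp_le_exp.2 (sum_neg_log_le ht n))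
      rw [Real.exp_sum]
      refine Finset.prod_congr rfl fun j _ => ?_
      rw [← Real.log_inv, Real.exp_log]
      refine inv_pos.2 ?_
      linarith [exp_neg_lt_one (x := t * ((j + 1 : ℕ) : ℝ)) (by positivity)]
  have h4 := h1.trans (h2.trans h3)
  rw [Real.exp_add]
  calc (F.card : ℝ) = Real.exp (t * n) * (F.card * Real.exp (-(t * n))) := by
        rw [mul_left_comm, ← Real.exp_add]
        simp
    _ ≤ _ := mul_le_mul_of_nonneg_left h4 (Real.exp_pos _).le

/-- A fraction `c` of the decay `t n` is reserved for a convergent geometric series; the rest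
absorbs `r √n` by completing the square. -/
theorem sum_exp_sqrt_le {r t c : ℝ} (ht : 0 < t) (hc : 0 < c) (hc1 : c < 1) (N : ℕ) :
    ∑ n ∈ Finset.range N, Real.exp (r * √n - t * n) ≤
      Real.exp (r ^ 2 / (4 * (1 - c) * t)) * ((1 + c * t) / (c * t)) := by
  have hct : 0 < c * t := by positivity
  have hx : Real.exp (-(c * t)) < 1 := exp_neg_lt_one hct
  have h1 : ∀ n ∈ Finset.range N, Real.exp (r * √n - t * n) ≤
      Real.exp (r ^ 2 / (4 * (1 - c) * t)) * Real.exp (-(c * t)) ^ n := fun n _ => by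
    rw [← Real.exp_nat_mul, ← Real.exp_add]
    refine Real.exp_le_exp.2 ?_
    have hd : 0 < (1 - c) * t := mul_pos (by linarith) ht
    have hn : √(n : ℝ) ^ 2 = n := Real.sq_sqrt n.cast_nonneg
    have : r * √n ≤ r ^ 2 / (4 * (1 - c) * t) + (1 - c) * t * √n ^ 2 := by
      rw [show 4 * (1 - c) * t = 4 * ((1 - c) * t) by ring]
      generalize (1 - c) * t = d at hd
      have h := sq_nonneg (r - 2 * d * √n)
      have : r ^ 2 / (4 * d) + d * √n ^ 2 - r * √n = (r - 2 * d * √n) ^ 2 / (4 * d) := by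
        field_simp
        ring
      have : 0 ≤ (r - 2 * d * √n) ^ 2 / (4 * d) := by positivity
      linarith
    rw [hn] at this
    linarith
  refine (Finset.sum_le_sum h1).trans ?_
  rw [← Finset.mul_sum]
  refine mul_le_mul_of_nonneg_left ((geom_sum_le_inv (Real.exp_pos _).le hx N).trans ?_)
    (Real.exp_pos _).le
  rw [inv_eq_one_div, div_le_div_iff₀ (by linarith) hct, Real.exp_neg]
  have he := Real.add_one_le_exp (c * t)
  have hep := Real.exp_pos (c * t)
  field_simp
  nlinarith

theorem sum_fiber_le {α : Type*} {len w : α → ℕ} {d : ℕ} (hlen : ∀ f, len f ≤ w f + d)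
    {K r : ℝ} (hcard : ∀ (n : ℕ) (F : Finset α), (∀ f ∈ F, len f = n) →
      (F.card : ℝ) ≤ K * Real.exp (r * √n)) (hK : 0 < K) {t c : ℝ} (ht : 0 < t) (hc : 0 < c)
    (hc1 : c < 1) (F : Finset α) :
    ∑ f ∈ F, Real.exp (-(t * w f)) ≤ Real.exp (t * d) * (K *
      (Real.exp (r ^ 2 / (4 * (1 - c) * t)) * ((1 + c * t) / (c * t)))) := by
  classical
  obtain ⟨N, hN⟩ : ∃ N, ∀ f ∈ F, len f ∈ Finset.range N :=
    ⟨F.sup len + 1, fun f hf => Finset.mem_range.2 (Nat.lt_succ_of_le (Finset.le_sup hf))⟩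
  calc ∑ f ∈ F, Real.exp (-(t * w f)) ≤ ∑ f ∈ F, Real.exp (t * d) * Real.exp (-(t * len f)) := by
        refine Finset.sum_le_sum fun f _ => ?_
        rw [← Real.exp_add]
        refine Real.exp_le_exp.2 ?_
        have : (len f : ℝ) ≤ w f + d := by exact_mod_cast hlen f
        nlinarith
    _ = Real.exp (t * d) * ∑ n ∈ Finset.range N, ∑ f ∈ F with len f = n,
          Real.exp (-(t * len f)) := by
        rw [← Finset.mul_sum, Finset.sum_fiberwise_of_maps_to hN]
    _ ≤ Real.exp (t * d) * ∑ n ∈ Finset.range N, K * Real.exp (r * √n - t * n) := by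
        refine mul_le_mul_of_nonneg_left (Finset.sum_le_sum fun n _ => ?_) (Real.exp_pos _).le
        rw [Finset.sum_congr rfl (g := fun _ => Real.exp (-(t * n))) fun f hf => by
          rw [(Finset.mem_filter.1 hf).2], Finset.sum_const, nsmul_eq_mul, sub_eq_add_neg,
          Real.exp_add, ← mul_assoc]
        exact mul_le_mul_of_nonneg_right (hcard n _ fun f hf => (Finset.mem_filter.1 hf).2)
          (Real.exp_pos _).le
    _ ≤ _ := by
        rw [← Finset.mul_sum]
        exact mul_le_mul_of_nonneg_left (mul_le_mul_of_nonneg_left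
          (sum_exp_sqrt_le ht hc hc1 N) hK.le) (Real.exp_pos _).le

/-- Let the multiplicity cutoff in the finite Euler product tend to infinity. -/
theorem prod_inv_le_of_sum_le {α : Type*} {q : α → ℝ} (hq : ∀ p, 0 ≤ q p) (hq1 : ∀ p, q p < 1)
    {B : ℝ} (hB : ∀ F : Finset (Multiset α), ∑ f ∈ F, (f.map q).prod ≤ B) (P : Finset α) :
    ∏ p ∈ P, (1 - q p)⁻¹ ≤ B := by
  have ht : Tendsto (fun K => ∏ p ∈ P, ∑ k ∈ Finset.range K, q p ^ k) atTop
      (𝓝 (∏ p ∈ P, (1 - q p)⁻¹)) :=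
    tendsto_finsetProd _ fun p _ => (hasSum_geometric_of_lt_one (hq p) (hq1 p)).tendsto_sum_nat
  refine le_of_tendsto ht ((eventually_gt_atTop 0).mono fun K hK => ?_)
  obtain ⟨G, -, hs⟩ := exists_finset_multiset P hK q
  exact hs ▸ hB G

/-- The logarithm of the Euler product is expanded as a double series and truncated at `m₀`. Summing
over `j` gives `exp (-(t s (m + 1))) / (1 - exp (-(t (m + 1))))`, and `1 - exp (-u) ≤ u` bounds this
below. The factor `t` makes both sides bounded as `t → 0`. -/
theorem sum_exp_div_sq_le {ι : Type*} [Fintype ι] {s : ℕ} (hs : 0 < s) {t B : ℝ} (ht : 0 < t)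
    (hB : ∀ F : Finset (Multiset (ι × ℕ)),
      ∑ f ∈ F, Real.exp (-(t * (f.map fun p => p.2 + s).sum)) ≤ B) (m₀ : ℕ) :
    Fintype.card ι * ∑ m ∈ Finset.range m₀, Real.exp (-(t * s * (m + 1))) / ((m : ℝ) + 1) ^ 2 ≤
      t * Real.log B := by
  set x : ℕ → ℝ := fun j => Real.exp (-(t * ((j + s : ℕ) : ℝ))) with hx
  have hx0 : ∀ j, 0 < x j := fun j => Real.exp_pos _
  have hx1 : ∀ j, x j < 1 := fun j => exp_neg_lt_one (by positivity)
  have h1 : ∀ J : ℕ, Fintype.card ι * ∑ j ∈ Finset.range J, -Real.log (1 - x j) ≤ Real.log B := by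
    intro J
    have h := prod_inv_le_of_sum_le (q := fun p : ι × ℕ => x p.2) (fun p => (hx0 _).le)
      (fun p => hx1 _) (B := B) (fun F => by
        refine le_trans (le_of_eq (Finset.sum_congr rfl fun f _ => ?_)) (hB F)
        exact prod_map_exp f (fun p => p.2 + s) t) (Finset.univ ×ˢ Finset.range J)
    rw [Finset.prod_product_right] at h
    simp only [Finset.prod_const, Finset.card_univ] at h
    rw [Finset.prod_pow] at h
    have hpos : 0 < ∏ j ∈ Finset.range J, (1 - x j)⁻¹ :=
      Finset.prod_pos fun j _ => inv_pos.2 (by linarith [hx1 j])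
    refine le_trans (le_of_eq ?_) (Real.log_le_log (pow_pos hpos _) h)
    rw [Real.log_pow, Real.log_prod fun j _ => (inv_pos.2 (by linarith [hx1 j])).ne']
    simp
  have h2 : ∀ J : ℕ, Fintype.card ι * ∑ m ∈ Finset.range m₀,
      (∑ j ∈ Finset.range J, x j ^ (m + 1)) / ((m : ℝ) + 1) ≤ Real.log B := by
    intro J
    refine le_trans (mul_le_mul_of_nonneg_left ?_ (Nat.cast_nonneg _)) (h1 J)
    simp_rw [Finset.sum_div]
    rw [Finset.sum_comm]
    refine Finset.sum_le_sum fun j _ => ?_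
    refine sum_le_hasSum _ (fun m _ => by have := hx0 j; positivity)
      (Real.hasSum_pow_div_log_of_abs_lt_one ?_)
    rw [abs_of_pos (hx0 j)]
    exact hx1 j
  have h3 : ∀ m : ℕ, HasSum (fun j => x j ^ (m + 1))
      (Real.exp (-(t * s * (m + 1))) * (1 - Real.exp (-(t * (m + 1))))⁻¹) := by
    intro m
    have : (fun j => x j ^ (m + 1)) =
        fun j => Real.exp (-(t * s * (m + 1))) * Real.exp (-(t * ((m : ℝ) + 1))) ^ j := by
      ext j
      rw [hx, ← Real.exp_nat_mul, ← Real.exp_nat_mul, ← Real.exp_add]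
      push_cast
      ring_nf
    rw [this]
    exact (hasSum_geometric_of_lt_one (Real.exp_pos _).le
      (exp_neg_lt_one (by positivity))).mul_left _
  have h4 : Fintype.card ι * ∑ m ∈ Finset.range m₀,
      (Real.exp (-(t * s * (m + 1))) * (1 - Real.exp (-(t * (m + 1))))⁻¹) / ((m : ℝ) + 1) ≤
        Real.log B :=
    le_of_tendsto' ((tendsto_finsetSum _ fun m _ =>
      ((h3 m).tendsto_sum_nat.div_const _)).const_mul _) h2
  refine le_trans ?_ (mul_le_mul_of_nonneg_left h4 ht.le)
  rw [mul_left_comm, Finset.mul_sum _ _ t]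
  refine mul_le_mul_of_nonneg_left (Finset.sum_le_sum fun m _ => ?_) (Nat.cast_nonneg _)
  have hm : 0 < t * ((m : ℝ) + 1) := by positivity
  have h5 : (t * ((m : ℝ) + 1))⁻¹ ≤ (1 - Real.exp (-(t * (m + 1))))⁻¹ := by
    refine inv_anti₀ (by linarith [exp_neg_lt_one hm]) ?_
    linarith [Real.add_one_le_exp (-(t * ((m : ℝ) + 1)))]
  calc Real.exp (-(t * s * (m + 1))) / ((m : ℝ) + 1) ^ 2
      = t * (Real.exp (-(t * s * (m + 1))) * (t * ((m : ℝ) + 1))⁻¹ / ((m : ℝ) + 1)) := by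
        field_simp
    _ ≤ _ := by gcongr

/-- Let `t → 0`, then `c → 0`, then `m₀ → ∞`. The first limit removes the shift `s`, the constants
`d` and `K`, and the logarithmic terms, since `t log t → 0`. -/
theorem card_mul_pi_sq_le {ι : Type*} [Fintype ι] {s d : ℕ} (hs : 0 < s)
    {len : Multiset (ι × ℕ) → ℕ} (hlen : ∀ f, len f ≤ (f.map fun p => p.2 + s).sum + d)
    {K r : ℝ} (hK : 0 < K) (hcard : ∀ (n : ℕ) (F : Finset (Multiset (ι × ℕ))),
      (∀ f ∈ F, len f = n) → (F.card : ℝ) ≤ K * Real.exp (r * √n)) :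
    Fintype.card ι * (Real.pi ^ 2 / 6) ≤ r ^ 2 / 4 := by
  have key : ∀ (m₀ : ℕ) (c : ℝ), 0 < c → c < 1 →
      Fintype.card ι * ∑ m ∈ Finset.range m₀, 1 / ((m : ℝ) + 1) ^ 2 ≤ r ^ 2 / (4 * (1 - c)) := by
    intro m₀ c hc hc1
    have hle : ∀ᶠ t : ℝ in 𝓝[>] 0,
        Fintype.card ι * ∑ m ∈ Finset.range m₀,
          Real.exp (-(t * s * (m + 1))) / ((m : ℝ) + 1) ^ 2 ≤
        t * (t * d) + t * Real.log K + r ^ 2 / (4 * (1 - c)) + t * Real.log (1 + c * t)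
          - t * Real.log c - t * Real.log t := by
      filter_upwards [self_mem_nhdsWithin] with t ht
      have ht : 0 < t := ht
      refine (sum_exp_div_sq_le hs ht
        (fun F => sum_fiber_le hlen hcard hK ht hc hc1 F) m₀).trans (le_of_eq ?_)
      have h1c : 0 < 1 - c := by linarith
      rw [Real.log_mul (Real.exp_pos _).ne' (by positivity), Real.log_mul hK.ne' (by positivity),
        Real.log_mul (Real.exp_pos _).ne' (by positivity), Real.log_div (by positivity)
        (by positivity), Real.log_mul hc.ne' ht.ne', Real.log_exp, Real.log_exp]
      field_simp
      ring
    have hL : Tendsto (fun t : ℝ => (Fintype.card ι : ℝ) * ∑ m ∈ Finset.range m₀,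
        Real.exp (-(t * s * (m + 1))) / ((m : ℝ) + 1) ^ 2) (𝓝[>] 0)
        (𝓝 ((Fintype.card ι : ℝ) * ∑ m ∈ Finset.range m₀, 1 / ((m : ℝ) + 1) ^ 2)) := by
      have hcont : Continuous (fun t : ℝ => (Fintype.card ι : ℝ) * ∑ m ∈ Finset.range m₀,
        Real.exp (-(t * s * (m + 1))) / ((m : ℝ) + 1) ^ 2) := by fun_prop
      simpa using (hcont.tendsto 0).mono_left nhdsWithin_le_nhds
    have hR : Tendsto (fun t : ℝ => t * (t * d) + t * Real.log K + r ^ 2 / (4 * (1 - c)) +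
        t * Real.log (1 + c * t) - t * Real.log c - t * Real.log t) (𝓝[>] 0)
        (𝓝 (r ^ 2 / (4 * (1 - c)))) := by
      have hcont : ContinuousAt (fun t : ℝ => t * (t * d) + t * Real.log K +
          r ^ 2 / (4 * (1 - c)) + t * Real.log (1 + c * t) - t * Real.log c -
            t * Real.log t) 0 := by
        have : ContinuousAt (fun t : ℝ => Real.log (1 + c * t)) 0 :=
          ContinuousAt.log (by fun_prop) (by simp)
        have := Real.continuous_mul_log.continuousAt (x := (0 : ℝ))
        fun_prop
      simpa using hcont.tendsto.mono_left (nhdsWithin_le_nhds (s := Set.Ioi 0))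
    exact le_of_tendsto_of_tendsto hL hR hle
  have h1 : ∀ m₀ : ℕ, Fintype.card ι * ∑ m ∈ Finset.range m₀, 1 / ((m : ℝ) + 1) ^ 2 ≤
      r ^ 2 / 4 := by
    intro m₀
    have ht : Tendsto (fun c : ℝ => r ^ 2 / (4 * (1 - c))) (𝓝[>] 0) (𝓝 (r ^ 2 / 4)) := by
      have : ContinuousAt (fun c : ℝ => r ^ 2 / (4 * (1 - c))) 0 :=
        ContinuousAt.div (by fun_prop) (by fun_prop) (by simp)
      simpa using this.tendsto.mono_left nhdsWithin_le_nhds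
    refine ge_of_tendsto ht ?_
    filter_upwards [Ioo_mem_nhdsGT (zero_lt_one (α := ℝ))] with c hc
    exact key m₀ c hc.1 hc.2
  have h2 : HasSum (fun m : ℕ => 1 / ((m : ℝ) + 1) ^ 2) (Real.pi ^ 2 / 6) := by
    simpa using (hasSum_nat_add_iff' 1).2 hasSum_zeta_two
  exact le_of_tendsto' (h2.tendsto_sum_nat.const_mul _) h1

end Asymptotics

section ConjugacyGrowth

open Filter

variable {X H : Type*} [Group H]

/-! ### Conjugacy growth -/

theorem conjLength_mk_le {G : Type*} [Group G] {S : Set G} {n : ℕ} {w : G} (hw : WordLe S n w) :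
    conjLength S (ConjClasses.mk w) ≤ n := by
  obtain ⟨l, hl, hln, rfl⟩ := hw
  refine (iInf₂_le l.prod ConjClasses.mem_carrier_mk).trans ((iInf₂_le l.length ?_).trans ?_)
  · exact ⟨l, rfl, hl, rfl⟩
  · exact_mod_cast hln

theorem exists_wordLe_of_conjLength_le {G : Type*} [Group G] {S : Set G} {n : ℕ}
    {c : ConjClasses G} (hc : conjLength S c ≤ n) : ∃ w, WordLe S n w ∧ ConjClasses.mk w = c := by
  have h : conjLength S c < (n + 1 : ℕ) := hc.trans_lt (by exact_mod_cast n.lt_succ_self)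
  simp only [conjLength, wordLength, iInf_lt_iff] at h
  obtain ⟨g, hg, m, ⟨l, rfl, hl, rfl⟩, hm⟩ := h
  exact ⟨l.prod, ⟨l, hl, Nat.lt_succ_iff.1 (by exact_mod_cast hm), rfl⟩,
    ConjClasses.mem_carrier_iff_mk_eq.1 hg⟩

/-- The coloured part that encodes a nontrivial shape. -/
noncomputable def shapePart (s : ℕ × ConjClasses H) : ConjClasses H × ℕ :=
  (s.2, shapeWeight s - 1)

open scoped Classical in
/-- The shape encoded by a coloured part. -/
noncomputable def partToShape (p : ConjClasses H × ℕ) : ℕ × ConjClasses H :=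
  (if p.1 = ConjClasses.mk 1 then p.2 + 1 else p.2, p.1)

theorem partToShape_shapePart {s : ℕ × ConjClasses H} (hs : s ≠ trivialShape H) :
    partToShape (shapePart s) = s ∧ shapeWeight s - 1 + 1 = shapeWeight s := by
  obtain ⟨n, κ⟩ := s
  by_cases hκ : κ = ConjClasses.mk 1
  · subst hκ
    have hn : n ≠ 0 := by
      rintro rfl
      exact hs rfl
    simp only [partToShape, shapePart, shapeWeight, ↓reduceIte, Prod.mk.injEq, and_true]
    omega
  · simp [partToShape, shapePart, shapeWeight, hκ]

theorem ne_trivialShape_of_mem_shapes {D : List (CycleBlock X H)} {s : ℕ × ConjClasses H}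
    (hs : s ∈ shapes D) : s ≠ trivialShape H := by
  classical
  exact (Multiset.mem_filter.1 hs).2

/-- A nontrivial shape has weight at least `1` and is recovered from its class and weight, so a
class of length `n` is encoded by a coloured partition of an integer at most `2 * n`. -/
theorem card_conjClasses_le [Finite H] [Infinite X] {S : Set (AltWreath H X)}
    (hS : S ⊆ pointGens H X ∪ threeCycGens H X) {n : ℕ} (F : Finset (ConjClasses (AltWreath H X)))
    (hF : ∀ c ∈ F, conjLength S c = n) {t : ℝ} (ht : 0 < t) :
    (F.card : ℝ) ≤ Real.exp (t * (2 * n) +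
      Nat.card (ConjClasses H) * (Real.pi ^ 2 / (6 * t))) := by
  classical
  have := Fintype.ofFinite (ConjClasses H)
  have h : ∀ c : ConjClasses (AltWreath H X), ∃ f : Multiset (ConjClasses H × ℕ), c ∈ F →
      (f.map fun p => p.2 + 1).sum ≤ 2 * n ∧ ∃ (w : AltWreath H X) (D : List (CycleBlock X H)),
        CycleDecomp (wreathAct w) D ∧ ConjClasses.mk w = c ∧ f = (shapes D).map shapePart := by
    intro c
    by_cases hc : c ∈ F
    · obtain ⟨w, ⟨l, hl, hln, rfl⟩, rfl⟩ := exists_wordLe_of_conjLength_le (hF c hc).le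
      obtain ⟨D, hD, hw⟩ := exists_cycleDecomp_prod hS l hl
      refine ⟨_, fun _ => ⟨?_, _, D, hD, rfl, rfl⟩⟩
      rw [Multiset.map_map,
        Multiset.map_congr (f := (fun p : ConjClasses H × ℕ => p.2 + 1) ∘ shapePart)
        (g := shapeWeight) rfl fun s hs =>
          (partToShape_shapePart (ne_trivialShape_of_mem_shapes hs)).2]
      exact hw.trans (by omega)
    -- An arbitrary value outside `F`, so that the choice function is total.
    · exact ⟨0, fun h => absurd h hc⟩
  choose f hf using h
  have hinj : Set.InjOn f F := by
    intro c hc c' hc' hcc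
    obtain ⟨-, w, D, hD, rfl, hfc⟩ := hf c hc
    obtain ⟨-, w', D', hD', rfl, hfc'⟩ := hf c' hc'
    have hdec : ∀ D : List (CycleBlock X H),
        ((shapes D).map shapePart).map partToShape = shapes D := fun D => by
      rw [Multiset.map_map, Multiset.map_congr (f := partToShape ∘ shapePart) (g := id) rfl
        fun s hs => (partToShape_shapePart (ne_trivialShape_of_mem_shapes hs)).1, Multiset.map_id]
    refine ConjClasses.mk_eq_mk_iff_isConj.2 (hD.isConj hD' ?_)
    rw [← hdec D, ← hdec D', ← hfc, ← hfc', hcc]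
  have hcard := card_partitions_le (F.image f) (2 * n) (fun g hg => by
    obtain ⟨c, hc, rfl⟩ := Finset.mem_image.1 hg
    exact (hf c hc).1) ht
  rw [Finset.card_image_of_injOn hinj] at hcard
  rw [Nat.card_eq_fintype_card]
  exact_mod_cast hcard

/-- A uniform bound on the finite subsets also forces `s` to be finite. -/
theorem encard_le_ofReal {α : Type*} {s : Set α} {B : ℝ}
    (h : ∀ F : Finset α, (∀ x ∈ F, x ∈ s) → (F.card : ℝ) ≤ B) :
    ((s.encard : ℕ∞) : ENNReal) ≤ ENNReal.ofReal B := by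
  have hs : s.Finite := by
    by_contra hs
    obtain ⟨F, hF, hc⟩ := Set.Infinite.exists_subset_card_eq hs (⌊B⌋₊ + 1)
    have h1 := h F fun x hx => hF hx
    rw [hc] at h1
    exact (Nat.lt_floor_add_one B).not_ge (by exact_mod_cast h1)
  rw [← hs.coe_toFinset, Set.encard_coe_eq_coe_finsetCard]
  have h1 := h hs.toFinset fun x hx => hs.mem_toFinset.1 hx
  rw [ENat.toENNReal_coe, ← ENNReal.ofReal_natCast]
  exact ENNReal.ofReal_le_ofReal h1

theorem card_le_of_encard_le {α : Type*} {s : Set α} {B : ℝ} (hB : 0 ≤ B)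
    (h : ((s.encard : ℕ∞) : ENNReal) ≤ ENNReal.ofReal B) (F : Finset α) (hF : ∀ x ∈ F, x ∈ s) :
    (F.card : ℝ) ≤ B := by
  have h1 : (F : Set α).encard ≤ s.encard := Set.encard_le_encard hF
  rw [Set.encard_coe_eq_coe_finsetCard] at h1
  have h2 := (ENat.toENNReal_le.2 h1).trans h
  rw [ENat.toENNReal_coe, ← ENNReal.ofReal_natCast] at h2
  exact (ENNReal.ofReal_le_ofReal_iff hB).1 h2

theorem log_ofReal_exp (x : ℝ) : ENNReal.log (ENNReal.ofReal (Real.exp x)) = x := by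
  rw [ENNReal.log_ofReal_of_pos (Real.exp_pos x), Real.log_exp]

theorem log_div_sqrt_le_iff {a : ENNReal} {n : ℕ} (hn : 0 < n) (r : ℝ) :
    ENNReal.log a / ((√(n : ℝ) : ℝ) : EReal) ≤ r ↔ a ≤ ENNReal.ofReal (Real.exp (r * √n)) := by
  have h : (0 : ℝ) < √n := Real.sqrt_pos.2 (by exact_mod_cast hn)
  rw [EReal.div_le_iff_le_mul (by exact_mod_cast h) (EReal.coe_ne_top _), ← EReal.coe_mul,
    mul_comm, ← log_ofReal_exp, ENNReal.log_le_log_iff]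

theorem conjGrowthRate_le [Finite H] [Infinite X] {S : Set (AltWreath H X)}
    (hS : S ⊆ pointGens H X ∪ threeCycGens H X) :
    conjGrowthRate S ≤ ((2 * Real.pi * √((Nat.card (ConjClasses H) : ℝ) / 3) : ℝ) : EReal) := by
  refine limsup_le_of_le (by isBoundedDefault) ((eventually_gt_atTop 0).mono fun n hn => ?_)
  refine (log_div_sqrt_le_iff hn _).2 (encard_le_ofReal fun F hF => ?_)
  have hM : (0 : ℝ) < Nat.card (ConjClasses H) := by exact_mod_cast Nat.card_pos
  set m := √((Nat.card (ConjClasses H) : ℝ) / 3) with hm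
  have hm0 : 0 < m := Real.sqrt_pos.2 (by positivity)
  have hm2 : (Nat.card (ConjClasses H) : ℝ) = 3 * m ^ 2 := by
    rw [hm, Real.sq_sqrt (by positivity)]
    ring
  set y := √(n : ℝ) with hy
  have hy0 : 0 < y := Real.sqrt_pos.2 (by exact_mod_cast hn)
  have hy2 : (n : ℝ) = y ^ 2 := by rw [hy, Real.sq_sqrt n.cast_nonneg]
  have hπ := Real.pi_pos
  -- This `t` balances the two terms `2 n t` and `M π² / (6 t)` of the exponent.
  refine (card_conjClasses_le hS F hF (t := Real.pi * m / (2 * y)) (by positivity)).trans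
    (Real.exp_le_exp.2 (le_of_eq ?_))
  rw [hm2, hy2]
  field_simp
  ring

theorem le_conjGrowthRate [Finite H] [Infinite X] {S : Set (AltWreath H X)}
    (hS : IsSufficientlyLarge S) :
    ((2 * Real.pi * √((Nat.card (ConjClasses H) : ℝ) / 3) : ℝ) : EReal) ≤ conjGrowthRate S := by
  classical
  have := Fintype.ofFinite (ConjClasses H)
  have hM : (0 : ℝ) < Nat.card (ConjClasses H) := by exact_mod_cast Nat.card_pos
  by_contra! hlt
  obtain ⟨r₀, hr₀, hr₀R⟩ := EReal.lt_iff_exists_real_btwn.1 hlt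
  have hπ := Real.pi_pos
  -- Nonnegativity gives `exp (r √n) ≥ 1` for small `n` and lets the strict inequality be squared at
  -- the end.
  obtain ⟨r, hr, hrr, hrR⟩ : ∃ r : ℝ, 0 ≤ r ∧ r₀ ≤ r ∧
      r < 2 * Real.pi * √((Nat.card (ConjClasses H) : ℝ) / 3) :=
    ⟨max r₀ 0, le_max_right _ _, le_max_left _ _,
      max_lt (by exact_mod_cast hr₀R) (by positivity)⟩
  obtain ⟨n₀, hn₀⟩ := eventually_atTop.1 (eventually_lt_of_limsup_lt hr₀)
  -- The constant absorbs the lengths up to `n₀`, through the upper bound at `t = 1`. For `n ≥ n₀ +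
  -- 1` the limsup bound applies, and `√n` is positive.
  set K := Real.exp (2 * (n₀ + 1 : ℕ) + Nat.card (ConjClasses H) * (Real.pi ^ 2 / 6)) with hKdef
  have hK : 1 ≤ K := Real.one_le_exp (by positivity)
  have hcard : ∀ (n : ℕ) (F : Finset (ConjClasses (AltWreath H X))),
      (∀ c ∈ F, conjLength S c = n) → (F.card : ℝ) ≤ K * Real.exp (r * √n) := by
    intro n F hF
    rcases lt_or_ge n (n₀ + 1) with hn | hn
    · refine (card_conjClasses_le hS.subset F hF zero_lt_one).trans ?_
      have h1 : (1 : ℝ) ≤ Real.exp (r * √n) := Real.one_le_exp (by positivity)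
      have h2 : Real.exp (1 * (2 * n) + Nat.card (ConjClasses H) * (Real.pi ^ 2 / (6 * 1))) ≤ K := by
        refine Real.exp_le_exp.2 ?_
        have : (n : ℝ) ≤ (n₀ + 1 : ℕ) := by exact_mod_cast hn.le
        rw [mul_one, one_mul]
        linarith
      exact h2.trans (le_mul_of_one_le_right (by linarith) h1)
    · have h1 := ((hn₀ n (by omega)).le.trans (EReal.coe_le_coe_iff.2 hrr))
      have h2 := card_le_of_encard_le (Real.exp_pos _).le
        ((log_div_sqrt_le_iff (by omega) r).1 h1) F hF
      exact h2.trans (le_mul_of_one_le_left (Real.exp_pos _).le hK)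
  choose w D hw hD hshape using fun f : Multiset ((ConjClasses H × Bool) × ℕ) =>
    hS.exists_of_parts f
  have hinj : Function.Injective fun f => ConjClasses.mk (w f) := fun f g hfg => by
    have hs := (hD f).shapes_eq_of_isConj (hD g) (ConjClasses.mk_eq_mk_iff_isConj.1 hfg)
    refine Multiset.map_injective partShape_injective ?_
    rw [← hshape f, ← hshape g, hs]
  have hfin : ∀ f, conjLength S (ConjClasses.mk (w f)) ≠ ⊤ := fun f =>
    ((conjLength_mk_le (hw f)).trans_lt (ENat.natCast_lt_top _)).ne
  -- With `2M` colours this yields `2M π² / 6 ≤ r² / 4`, against `r² < 4π² M / 3`. The values `s =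
  -- 3` and `d = 2` are the word cost in `IsSufficientlyLarge.exists_of_parts`.
  have hfinal := card_mul_pi_sq_le (ι := ConjClasses H × Bool) (s := 3) (d := 2) (by norm_num)
    (len := fun f => (conjLength S (ConjClasses.mk (w f))).toNat)
    (fun f => ENat.toNat_le_of_le_natCast (conjLength_mk_le (hw f))) (K := K) (r := r)
    (by linarith) (fun n F hF => by
      rw [← Finset.card_image_of_injective F hinj]
      refine hcard n _ fun c hc => ?_
      obtain ⟨f, hf, rfl⟩ := Finset.mem_image.1 hc
      rw [← hF f hf, ENat.natCast_toNat (hfin f)])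
  have hsq : r ^ 2 < (2 * Real.pi * √((Nat.card (ConjClasses H) : ℝ) / 3)) ^ 2 :=
    pow_lt_pow_left₀ hrR hr two_ne_zero
  rw [mul_pow, Real.sq_sqrt (by positivity)] at hsq
  rw [Fintype.card_prod, Fintype.card_bool, ← Nat.card_eq_fintype_card] at hfinal
  push_cast at hfinal
  linarith

end ConjugacyGrowth

theorem mainTheorem10 {H X : Type*} [Group H] [Finite H] [Infinite X]
    (S : Set (AltWreath H X)) (hS : IsSufficientlyLarge S) :
    conjGrowthRate S =
      ((2 * Real.pi * Real.sqrt ((Nat.card (ConjClasses H) : ℝ) / 3) : ℝ) : EReal) :=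
  le_antisymm (conjGrowthRate_le hS.subset) (le_conjGrowthRate hS)
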